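/- Let $\Omega_0,\Omega\subseteq\mathbb R^3$ be open (the body and the region of space it occupies), and let $\rho_0,s_0:\Omega_0\to\mathbb R$ be smooth reference densities of mass and entropy. A \emph{placement} is a smooth bijection $x:\Omega_0\to\Omega$ with $\det\partial x/\partial X>0$. To a placement $x$ with inverse $X(\cdot)$ and a smooth Lagrangian momentum density $M:\Omega_0\to\mathbb R^3$ associate the Eulerian fields on $\Omega$ $$\rho(y)=\rho_0(X(y))\det\tfrac{\partial X}{\partial x}(y),\quad m(y)=M(X(y))\det\tfrac{\partial X}{\partial x}(y),\quad s(y)=s_0(X(y))\det\tfrac{\partial X}{\partial x}(y),\quad F^i_I(y)=\tfrac{\partial x^i}{\partial X^I}(X(y)),$$ and write $\pi(x,M)=(\rho,m,s,F)$. The functional derivative $\delta\Phi/\delta f$ of a functional $\Phi$ is defined by $\frac{d}{d\lambda}\big|_{\lambda=0}\Phi(f+\lambda h)=\int\frac{\delta\Phi}{\delta f}\cdot h$ for all $h\in C_c^\infty$. Functionals $C$ of $q=(\rho,m,s,F)$ are called differentiable at $q$ if they are Fréchet differentiable along $C_c^\infty(\Omega)$ variations (for each compact $K\subset\Omega$,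 with respect to some $C^k$ norm on the variations supported in $K$), with differential represented by a smooth field $(C_\rho,C_m,C_s,C_F)$ on $\Omega$. The canonical Lagrangian bracket is $$\{A,B\}^{(L)}=\int_{\Omega_0}\Big(\frac{\delta A}{\delta x^i}\frac{\delta B}{\delta M_i}-\frac{\delta B}{\delta x^i}\frac{\delta A}{\delta M_i}\Big)dX,$$ with continuous functional derivatives, and the Eulerian bracket is $$\begin{aligned}\{C,D\}^{(Eu)}={}&\int_\Omega \big[\rho(\partial_iC_\rho D_{m_i}-\partial_iD_\rho C_{m_i})+m_i(\partial_jC_{m_i}D_{m_j}-\partial_jD_{m_i}C_{m_j})+s(\partial_iC_sD_{m_i}-\partial_iD_sC_{m_i})\big]dy\\&+\int_\Omega F^j_I\big(C_{F^i_I}\partial_jD_{m_i}-D_{F^i_I}\partial_jC_{m_i}\big)dy-\int_\Omega\partial_kF^i_I\big(C_{F^i_I}D_{m_k}-D_{F^i_I}C_{m_k}\big)dy,\end{aligned}$$ with summation over repeated indices. \textbf{Theorem.} (1) Let $x$ be a placement, $M$ smooth, and let $C,D$ be functionals of the Eulerian fields that are differentiable at $\pi(x,M)$, such that outside a compact subset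 of $\Omega$ either both $C_m$ and $D_m$ vanish, or all of $(C_\rho,C_m,C_s,C_F)$ vanishes, or all of $(D_\rho,D_m,D_s,D_F)$ vanishes. Then $C\circ\pi$ and $D\circ\pi$ have continuous functional derivatives with respect to $x$ and $M$ at $(x,M)$, the integrals in both brackets converge, and $$\{C\circ\pi,D\circ\pi\}^{(L)}(x,M)=\{C,D\}^{(Eu)}(\pi(x,M)).$$ (2) The Eulerian bracket expresses the kinematics of $(\rho,m,s,F)$: let $E$ be a functional of the Eulerian fields, let $J\subseteq\mathbb R$ be open and let $(x(t),M(t))$, $t\in J$, be a motion, smooth in $(t,X)$, by placements $\Omega_0\to\Omega$ that satisfies the canonical equations $\partial_tx=\delta(E\circ\pi)/\delta M$, $\partial_tM=-\delta(E\circ\pi)/\delta x$ (with continuous functional derivatives), with $E$ differentiable at $q(t)=\pi(x(t),M(t))$ for all $t\in J$. Then for every $t\in J$ and every functional $C$ that depends only on the values of the fields in some compact subset of $\Omega$ and is differentiable at $q(t)$, the integrals in $\{C,E\}^{(Eu)}(q(t))$ converge and $$\frac{d}{dt}C(q(t))=\{C,E\}^{(Eu)}(q(t)).$$ -/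

import Mathlib

open MeasureTheory Set
open scoped ContDiff

/-- Physical (and reference) space, with Cartesian coordinates. -/
abbrev Space3 : Type := EuclideanSpace ℝ (Fin 3)

/-- The value at a point of the Eulerian fields `(ρ, m, s, F)`; the deformation gradient is stored
as `F i I`, with `i` the Eulerian and `I` the Lagrangian index. -/
abbrev EulerValue : Type := ℝ × Space3 × ℝ × (Fin 3 → Fin 3 → ℝ)

namespace EulerValue

/-- Mass density. -/
def rho (a : EulerValue) : ℝ := a.1

/-- Momentum density. -/
def mom (a : EulerValue) : Space3 := a.2.1

/-- Entropy density. -/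
def ent (a : EulerValue) : ℝ := a.2.2.1

/-- Deformation gradient. -/
def dfg (a : EulerValue) : Fin 3 → Fin 3 → ℝ := a.2.2.2

/-- The pointwise pairing of a functional derivative with a variation of the Eulerian fields. -/
def pairing (a b : EulerValue) : ℝ :=
  a.rho * b.rho + (∑ i, a.mom i * b.mom i) + a.ent * b.ent + ∑ i, ∑ I, a.dfg i I * b.dfg i I

end EulerValue

noncomputable section

/-- The partial derivative `∂ᵢ f` at `y`. -/
def pderiv (i : Fin 3) (f : Space3 → ℝ) (y : Space3) : ℝ :=
  fderiv ℝ f y (EuclideanSpace.single i 1)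

/-! ### Functional derivatives -/

/-- Smooth variations with compact support in `Ω`. -/
structure IsVariation {V : Type*} [NormedAddCommGroup V] [NormedSpace ℝ V]
    (Ω : Set Space3) (h : Space3 → V) : Prop where
  smooth : ContDiff ℝ ∞ h
  compact : HasCompactSupport h
  subset : tsupport h ⊆ Ω

/-- `g` is the functional (Volterra) derivative at `f` of the functional `Φ` of a vector field
on `Ω`: the derivative at `0` of `l ↦ Φ (f + l h)` is `∫ g · h` for all smooth compactly supported
variations `h`. -/
def HasFunctionalDeriv (Ω : Set Space3) (Φ : (Space3 → Space3) → ℝ) (f g : Space3 → Space3) :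
    Prop :=
  ∀ h : Space3 → Space3, IsVariation Ω h →
    HasDerivAt (fun l : ℝ => Φ (f + l • h)) (∫ X in Ω, ∑ i, g X i * h X i) 0

/-- The functional `Φ` of the Eulerian fields on `Ω` is Fréchet differentiable at `q` along the
smooth variations with compact support (for every compact `K ⊆ Ω`, with respect to some `C^k` norm
on the variations supported in `K`), and its differential is represented by the smooth field
`g = (Φ_ρ, Φ_m, Φ_s, Φ_F)`. -/
structure HasFrechetDeriv (Ω : Set Space3) (Φ : (Space3 → EulerValue) → ℝ)
    (q g : Space3 → EulerValue) : Prop where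
  smooth : ContDiffOn ℝ ∞ g Ω
  diff : ∀ K : Set Space3, IsCompact K → K ⊆ Ω → ∃ k : ℕ, ∀ ε : ℝ, 0 < ε → ∃ δ : ℝ, 0 < δ ∧
    ∀ h : Space3 → EulerValue, ContDiff ℝ ∞ h → tsupport h ⊆ K →
      ∀ r : ℝ, r ≤ δ → (∀ j ≤ k, ∀ y, ‖iteratedFDeriv ℝ j h y‖ ≤ r) →
        |Φ (q + h) - Φ q - ∫ y in Ω, (g y).pairing (h y)| ≤ ε * r

/-! ### The Lagrangian frame -/

/-- `x` is a smooth, invertible, orientation preserving placement of the body `Ω₀` onto the region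
`Ω` of physical space. -/
structure IsPlacement (Ω₀ Ω : Set Space3) (x : Space3 → Space3) : Prop where
  smooth : ContDiffOn ℝ ∞ x Ω₀
  bijOn : BijOn x Ω₀ Ω
  det_pos : ∀ X ∈ Ω₀, 0 < (fderiv ℝ x X).det

/-- `A` and `B` are the functional derivatives `δΨ/δx` and `δΨ/δM` at `(x, M)` of the functional
`Ψ` of the Lagrangian fields, and they are continuous on the body. -/
structure HasLagrangianDeriv (Ω₀ : Set Space3) (Ψ : (Space3 → Space3) → (Space3 → Space3) → ℝ)
    (x M A B : Space3 → Space3) : Prop where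
  cont_x : ContinuousOn A Ω₀
  cont_M : ContinuousOn B Ω₀
  deriv_x : HasFunctionalDeriv Ω₀ (fun x' => Ψ x' M) x A
  deriv_M : HasFunctionalDeriv Ω₀ (fun M' => Ψ x M') M B

/-- The integrand of the canonical Lagrangian bracket `{C, D}`, in terms of
`Cx = δC/δx`, `CM = δC/δM`, `Dx = δD/δx`, `DM = δD/δM`. -/
def lagrangianDensity (Cx CM Dx DM : Space3 → Space3) (X : Space3) : ℝ :=
  ∑ i, (Cx X i * DM X i - Dx X i * CM X i)

/-- The canonical Lagrangian Poisson bracket. -/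
def lagrangianBracket (Ω₀ : Set Space3) (Cx CM Dx DM : Space3 → Space3) : ℝ :=
  ∫ X in Ω₀, lagrangianDensity Cx CM Dx DM X

/-- `(x, M)` is, for times in `J`, a smooth motion of the body `Ω₀` in the region `Ω` that solves
the canonical equations `∂ₜ x = δH/δM`, `∂ₜ M = - δH/δx` with energy `H`. -/
structure IsHamiltonianMotion (Ω₀ Ω : Set Space3)
    (H : (Space3 → Space3) → (Space3 → Space3) → ℝ)
    (J : Set ℝ) (x M : ℝ → Space3 → Space3) : Prop where
  placement : ∀ t ∈ J, IsPlacement Ω₀ Ω (x t)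
  smooth_x : ContDiffOn ℝ ∞ (fun p : ℝ × Space3 => x p.1 p.2) (J ×ˢ Ω₀)
  smooth_M : ContDiffOn ℝ ∞ (fun p : ℝ × Space3 => M p.1 p.2) (J ×ˢ Ω₀)
  canonical : ∀ t ∈ J, ∃ Hx HM : Space3 → Space3,
    HasLagrangianDeriv Ω₀ H (x t) (M t) Hx HM ∧
      ∀ X ∈ Ω₀, HasDerivAt (fun τ => x τ X) (HM X) t ∧ HasDerivAt (fun τ => M τ X) (-Hx X) t

/-! ### The Eulerian frame -/

/-- The Eulerian fields on `Ω` of the Lagrangian state `(x, M)` of the body `Ω₀` with reference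
mass density `ρ₀` and reference entropy density `s₀`. With `X` the inverse of `x` they are
`ρ = ρ₀(X) det ∂X/∂x`, `m = M(X) det ∂X/∂x`, `s = s₀(X) det ∂X/∂x` and
`F i I = (∂xⁱ/∂X^I)(X)`. They are set to zero outside `Ω`, where they have no meaning. -/
def eulerianFields (Ω₀ Ω : Set Space3) (ρ₀ s₀ : Space3 → ℝ) (x M : Space3 → Space3) :
    Space3 → EulerValue :=
  Ω.indicator fun y =>
    let Xinv : Space3 → Space3 := Function.invFunOn x Ω₀
    let jac : ℝ := (fderiv ℝ Xinv y).det
    (ρ₀ (Xinv y) * jac, jac • M (Xinv y), s₀ (Xinv y) * jac,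
      fun i I => fderiv ℝ x (Xinv y) (EuclideanSpace.single I 1) i)

/-- The functional of the Lagrangian fields induced by a functional `C` of the Eulerian fields. -/
def pullback (Ω₀ Ω : Set Space3) (ρ₀ s₀ : Space3 → ℝ) (C : (Space3 → EulerValue) → ℝ)
    (x M : Space3 → Space3) : ℝ :=
  C (eulerianFields Ω₀ Ω ρ₀ s₀ x M)

/-- The integrand of the bracket of fluid mechanics at the state `q`, where `c` and `d` are the
functional derivatives of the two functionals. -/
def fluidDensity (q c d : Space3 → EulerValue) (y : Space3) : ℝ :=
  (∑ i, (q y).rho * (pderiv i (fun z => (c z).rho) y * (d y).mom i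
      - pderiv i (fun z => (d z).rho) y * (c y).mom i))
  + (∑ i, ∑ j, (q y).mom i * (pderiv j (fun z => (c z).mom i) y * (d y).mom j
      - pderiv j (fun z => (d z).mom i) y * (c y).mom j))
  + ∑ i, (q y).ent * (pderiv i (fun z => (c z).ent) y * (d y).mom i
      - pderiv i (fun z => (d z).ent) y * (c y).mom i)

/-- `F^j_I (C_{F^i_I} ∂_j D_{m_i} - D_{F^i_I} ∂_j C_{m_i})`. -/
def stretchDensity (q c d : Space3 → EulerValue) (y : Space3) : ℝ :=
  ∑ i, ∑ j, ∑ I, (q y).dfg j I * ((c y).dfg i I * pderiv j (fun z => (d z).mom i) y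
    - (d y).dfg i I * pderiv j (fun z => (c z).mom i) y)

/-- `∂_k F^i_I (C_{F^i_I} D_{m_k} - D_{F^i_I} C_{m_k})`. -/
def advectDensity (q c d : Space3 → EulerValue) (y : Space3) : ℝ :=
  ∑ i, ∑ k, ∑ I, pderiv k (fun z => (q z).dfg i I) y * ((c y).dfg i I * (d y).mom k
    - (d y).dfg i I * (c y).mom k)

/-- The Poisson bracket of fluid mechanics. -/
def fluidBracket (Ω : Set Space3) (q c d : Space3 → EulerValue) : ℝ :=
  ∫ y in Ω, fluidDensity q c d y

/-- The Eulerian Poisson bracket of the fields `(ρ, m, s, F)`. -/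
def eulerianBracket (Ω : Set Space3) (q c d : Space3 → EulerValue) : ℝ :=
  fluidBracket Ω q c d + (∫ y in Ω, stretchDensity q c d y) - ∫ y in Ω, advectDensity q c d y

/-- The integrals that define the Eulerian bracket converge. -/
structure EulerianBracketConverges (Ω : Set Space3) (q c d : Space3 → EulerValue) : Prop where
  fluid : IntegrableOn (fluidDensity q c d) Ω
  stretch : IntegrableOn (stretchDensity q c d) Ω
  advect : IntegrableOn (advectDensity q c d) Ω

/-- Outside a compact subset of `Ω`, either the momentum components of the functional derivatives
`c` and `d` both vanish, or one of `c` and `d` vanishes. -/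
def VanishAtBoundary (Ω : Set Space3) (c d : Space3 → EulerValue) : Prop :=
  ∃ K : Set Space3, IsCompact K ∧ K ⊆ Ω ∧
    ((∀ y ∈ Ω \ K, (c y).mom = 0 ∧ (d y).mom = 0) ∨
      (∀ y ∈ Ω \ K, c y = 0) ∨ (∀ y ∈ Ω \ K, d y = 0))

/-- The functional `C` only depends on the values of the Eulerian fields in some compact subset
of `Ω`. -/
def IsLocalized (Ω : Set Space3) (C : (Space3 → EulerValue) → ℝ) : Prop :=
  ∃ K : Set Space3, IsCompact K ∧ K ⊆ Ω ∧
    ∀ q q' : Space3 → EulerValue, (∀ y ∈ K, q y = q' y) → C q = C q'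

end

/-! Both parts rest on one formula for the rate of change of a functional of the Eulerian fields.
Along a smooth motion let v be the velocity in spatial coordinates and P the rate of M per unit
spatial volume, so that ∂ₜM = det(∂x/∂X) P(x). Liouville's formula and the symmetry of second
derivatives give the transport equations ∂ₜρ = -∂ⱼ(ρ vʲ), ∂ₜmᵢ = Pᵢ - ∂ⱼ(mᵢ vʲ), ∂ₜs = -∂ⱼ(s vʲ),
∂ₜF = (∂v) F - v·∂F (`IsSmoothMotion.isTransport`). Pairing them with (C_ρ, C_m, C_s, C_F) and
integrating by parts yields dC/dt = ∫ (f_C · v + C_m · P) dy, where f_C is `force q c`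
(`IsSmoothMotion.hasDerivAt_functional`).

For (1), the line x + l h is a motion with v = h(X), P = 0, and the line M + l h one with v = 0, P =
h(X)/det. The formula therefore gives δ(C∘π)/δx = det · f_C(x) and δ(C∘π)/δM = C_m(x). A change of
variables turns the Lagrangian bracket into ∫ (f_C · D_m - f_D · C_m) dy. This integrand differs
from the Eulerian one by a divergence (`bracketDensity_eq`), whose flux has compact support by the
condition at the boundary.

For (2), the canonical equations say v = E_m and P = -f_E, so the same formula produces the same
integral.

The analytic difficulty is that the Eulerian fields do not move along a straight line. Fréchet
differentiability handles this once their change is a smooth variation supported in a fixed compact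
set and of size O(|τ - t|) in every C^k norm (`exists_iteratedFDeriv_le`); a cutoff that the
functional does not notice arranges the support. In addition, x + l h must remain a placement for
small l (`IsPlacement.exists_perturbation`), and continuous functional derivatives must be unique.
-/

/-! ### Determinants, smooth inverses, and functions with compact support in an open set -/

lemma Space3.det_eq (A : Space3 →L[ℝ] Space3) :
    A.det = (Matrix.of fun i j => A (EuclideanSpace.single j 1) i).det := by
  have h := LinearMap.det_toMatrix (EuclideanSpace.basisFun (Fin 3) ℝ).toBasis (A : Space3 →ₗ[ℝ] Space3)
  rw [ContinuousLinearMap.det, ← h]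
  congr 1

lemma Space3.contDiff_det : ContDiff ℝ ∞ (fun A : Space3 →L[ℝ] Space3 => A.det) := by
  have hc : ∀ i j : Fin 3, ContDiff ℝ ∞ fun A : Space3 →L[ℝ] Space3 =>
      A (EuclideanSpace.single j 1) i := fun i j =>
    (EuclideanSpace.proj (𝕜 := ℝ) i).contDiff.comp
      (contDiff_id.clm_apply contDiff_const)
  simp only [Space3.det_eq, Matrix.det_fin_three, Matrix.of_apply]
  have := hc
  fun_prop (disch := assumption)

/-- The inverse of a smooth injective map with injective derivative is smooth. -/
lemma contDiffAt_invFunOn {E : Type*} [NormedAddCommGroup E] [NormedSpace ℝ E]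
    [FiniteDimensional ℝ E] [Nonempty E] {f : E → E} {U : Set E} (hU : IsOpen U)
    (hf : ContDiffOn ℝ ∞ f U) (hinj : InjOn f U) {a : E} (ha : a ∈ U)
    (hd : Function.Injective (fderiv ℝ f a)) :
    f '' U ∈ nhds (f a) ∧ ContDiffAt ℝ ∞ (Function.invFunOn f U) (f a) := by
  have : CompleteSpace E := FiniteDimensional.complete ℝ E
  have hfa : ContDiffAt ℝ ∞ f a := hf.contDiffAt (hU.mem_nhds ha)
  let e : E ≃L[ℝ] E :=
    (LinearEquiv.ofInjectiveEndo (fderiv ℝ f a : E →ₗ[ℝ] E) hd).toContinuousLinearEquiv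
  have he : HasFDerivAt f (e : E →L[ℝ] E) a := by
    have : (e : E →L[ℝ] E) = fderiv ℝ f a := by ext v; rfl
    rw [this]
    exact (hfa.differentiableAt (by simp)).hasFDerivAt
  have hn : (∞ : WithTop ℕ∞) ≠ 0 := by simp
  have hs : HasStrictFDerivAt f (e : E →L[ℝ] E) a := hfa.hasStrictFDerivAt' he hn
  have hg := hfa.to_localInverse he hn
  have hr := hs.eventually_right_inverse
  have hga : hfa.localInverse he hn (f a) = a := hfa.localInverse_apply_image he hn
  -- Once the local inverse takes values in `U`, injectivity of `f` on `U` forces it to agree with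
  -- `invFunOn` near `f a`.
  have hmem : ∀ᶠ b in nhds (f a), hfa.localInverse he hn b ∈ U :=
    hg.continuousAt.eventually (by rw [hga]; exact hU.mem_nhds ha)
  refine ⟨?_, hg.congr_of_eventuallyEq ?_⟩
  · filter_upwards [hr, hmem] with b h1 h2
    exact ⟨_, h2, h1⟩
  · filter_upwards [hr, hmem] with b h1 h2
    have hb : b ∈ f '' U := ⟨_, h2, h1⟩
    exact hinj (Function.invFunOn_mem hb) h2 ((Function.invFunOn_eq hb).trans h1.symm)

/-- A function that is smooth on an open set and vanishes there outside a compact set extends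
smoothly by zero. -/
lemma contDiff_indicator_of_compact {E V : Type*} [NormedAddCommGroup E] [NormedSpace ℝ E]
    [NormedAddCommGroup V] [NormedSpace ℝ V] {Ω K : Set E} (hΩ : IsOpen Ω) (hK : IsClosed K)
    (hKΩ : K ⊆ Ω) {f : E → V} {n : WithTop ℕ∞} (hf : ContDiffOn ℝ n f Ω)
    (h0 : ∀ y ∈ Ω \ K, f y = 0) : ContDiff ℝ n (Ω.indicator f) := by
  rw [contDiff_iff_contDiffAt]
  intro y
  by_cases hy : y ∈ Ω
  · refine (hf.contDiffAt (hΩ.mem_nhds hy)).congr_of_eventuallyEq ?_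
    filter_upwards [hΩ.mem_nhds hy] with z hz
    simp [hz]
  · refine (contDiffAt_const (c := (0 : V))).congr_of_eventuallyEq ?_
    filter_upwards [hK.isOpen_compl.mem_nhds (fun h => hy (hKΩ h))] with z hz
    by_cases hzΩ : z ∈ Ω
    · simp [hzΩ, h0 z ⟨hzΩ, hz⟩]
    · simp [hzΩ]

lemma hasCompactSupport_indicator {E V : Type*} [TopologicalSpace E] [T2Space E]
    [Zero V] {Ω K : Set E} (hK : IsCompact K) {f : E → V}
    (h0 : ∀ y ∈ Ω \ K, f y = 0) : HasCompactSupport (Ω.indicator f) := by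
  refine HasCompactSupport.intro hK fun y hy => ?_
  by_cases hyΩ : y ∈ Ω
  · simp [hyΩ, h0 y ⟨hyΩ, hy⟩]
  · simp [hyΩ]

/-- Continuity on `Ω` gives no control near its boundary; all integrability in the proof comes from
vanishing off a compact set. -/
lemma integrableOn_of_vanish {E : Type*} [TopologicalSpace E] [MeasurableSpace E]
    [OpensMeasurableSpace E] [T2Space E] {μ : Measure E} [IsFiniteMeasureOnCompacts μ]
    {Ω K : Set E} (hΩ : MeasurableSet Ω) (hK : IsCompact K) (hKΩ : K ⊆ Ω) {f : E → ℝ}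
    (hf : ContinuousOn f Ω) (h0 : ∀ y ∈ Ω \ K, f y = 0) : IntegrableOn f Ω μ :=
  ((hf.mono hKΩ).integrableOn_compact hK).of_forall_sdiff_eq_zero hΩ h0

/-- The integral of a partial derivative of a compactly supported function vanishes. -/
lemma integral_pderiv_eq_zero {Ω K : Set Space3} (hΩ : IsOpen Ω) (hK : IsCompact K)
    (hKΩ : K ⊆ Ω) {w : Space3 → ℝ} (hw : ContDiffOn ℝ ∞ w Ω) (h0 : ∀ y ∈ Ω \ K, w y = 0)
    (j : Fin 3) : ∫ y in Ω, pderiv j w y = 0 := by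
  have h1 : ContDiff ℝ 1 (Ω.indicator w) :=
    (contDiff_indicator_of_compact hΩ hK.isClosed hKΩ hw h0).of_le (by simp)
  have hc : HasCompactSupport (Ω.indicator w) := hasCompactSupport_indicator hK h0
  have hd : Continuous fun y => pderiv j (Ω.indicator w) y :=
    (h1.continuous_fderiv (by simp)).clm_apply continuous_const
  have hdc : HasCompactSupport fun y => pderiv j (Ω.indicator w) y := hc.fderiv_apply ℝ _
  -- Integration by parts over the whole space against the constant 1, whose derivative is zero.
  have key := integral_mul_fderiv_eq_neg_fderiv_mul_of_integrable (μ := volume)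
    (f := fun _ : Space3 => (1 : ℝ)) (g := Ω.indicator w) (v := EuclideanSpace.single j 1)
    (by simp) (by simpa [pderiv] using hd.integrable_of_hasCompactSupport hdc)
    (by simpa using h1.continuous.integrable_of_hasCompactSupport hc)
    (fun _ _ => differentiableAt_const _) (fun y _ => h1.differentiable (by simp) y)
  simp only [one_mul, fderiv_fun_const, Pi.zero_apply, zero_apply, zero_mul,
    integral_zero, neg_zero] at key
  have hout : ∀ y, y ∉ Ω → pderiv j (Ω.indicator w) y = 0 := by
    intro y hy
    have : Ω.indicator w =ᶠ[nhds y] fun _ => 0 := by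
      filter_upwards [hK.isClosed.isOpen_compl.mem_nhds (fun h => hy (hKΩ h))] with z hz
      by_cases hzΩ : z ∈ Ω
      · simp [hzΩ, h0 z ⟨hzΩ, hz⟩]
      · simp [hzΩ]
    simp [pderiv, this.fderiv_eq]
  rw [setIntegral_congr_fun (g := fun y => pderiv j (Ω.indicator w) y) hΩ.measurableSet,
    setIntegral_eq_integral_of_forall_compl_eq_zero hout]
  · exact key
  · intro y hy
    have : Ω.indicator w =ᶠ[nhds y] w := by
      filter_upwards [hΩ.mem_nhds hy] with z hz
      simp [hz]
    simp [pderiv, this.fderiv_eq]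

/-! ### The pairing of Eulerian values and its regularity -/

namespace EulerValue

/-- The mass density as a continuous linear map. -/
noncomputable def rhoL : EulerValue →L[ℝ] ℝ := ContinuousLinearMap.fst ℝ _ _

/-- The components of the momentum density as continuous linear maps. -/
noncomputable def momL (i : Fin 3) : EulerValue →L[ℝ] ℝ :=
  (EuclideanSpace.proj (𝕜 := ℝ) i).comp
    ((ContinuousLinearMap.fst ℝ _ _).comp (ContinuousLinearMap.snd ℝ _ _))

/-- The entropy density as a continuous linear map. -/
noncomputable def entL : EulerValue →L[ℝ] ℝ :=
  (ContinuousLinearMap.fst ℝ _ _).comp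
    ((ContinuousLinearMap.snd ℝ _ _).comp (ContinuousLinearMap.snd ℝ _ _))

/-- The components of the deformation gradient as continuous linear maps. -/
noncomputable def dfgL (i I : Fin 3) : EulerValue →L[ℝ] ℝ :=
  (ContinuousLinearMap.proj (R := ℝ) (φ := fun _ : Fin 3 => ℝ) I).comp
    ((ContinuousLinearMap.proj (R := ℝ) (φ := fun _ : Fin 3 => Fin 3 → ℝ) i).comp
      ((ContinuousLinearMap.snd ℝ _ _).comp
        ((ContinuousLinearMap.snd ℝ _ _).comp (ContinuousLinearMap.snd ℝ _ _))))

@[simp] lemma rhoL_apply (a : EulerValue) : rhoL a = a.rho := rfl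
@[simp] lemma momL_apply (i : Fin 3) (a : EulerValue) : momL i a = a.mom i := rfl
@[simp] lemma entL_apply (a : EulerValue) : entL a = a.ent := rfl
@[simp] lemma dfgL_apply (i I : Fin 3) (a : EulerValue) : dfgL i I a = a.dfg i I := rfl

/-- The pairing with a fixed functional derivative as a continuous linear map. -/
noncomputable def pairingL (a : EulerValue) : EulerValue →L[ℝ] ℝ :=
  a.rho • rhoL + (∑ i, a.mom i • momL i) + a.ent • entL + ∑ i, ∑ I, a.dfg i I • dfgL i I

@[simp] lemma pairingL_apply (a b : EulerValue) : a.pairingL b = a.pairing b := by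
  simp [pairingL, pairing]

lemma pairing_zero_left (b : EulerValue) : pairing 0 b = 0 := by
  simp [pairing, rho, mom, ent, dfg]

lemma pairing_zero_right (b : EulerValue) : pairing b 0 = 0 := by
  simp [pairing, rho, mom, ent, dfg]

lemma pairing_smul_right (r : ℝ) (a b : EulerValue) : a.pairing (r • b) = r * a.pairing b := by
  simp [← pairingL_apply]

section Regularity

variable {X : Type*} [NormedAddCommGroup X] [NormedSpace ℝ X] {n : WithTop ℕ∞} {S : Set X}
  {c d : X → EulerValue}

lemma contDiffOn_rho (hc : ContDiffOn ℝ n c S) : ContDiffOn ℝ n (fun y => (c y).rho) S :=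
  rhoL.contDiff.comp_contDiffOn hc

lemma contDiffOn_mom (hc : ContDiffOn ℝ n c S) (i : Fin 3) :
    ContDiffOn ℝ n (fun y => (c y).mom i) S :=
  (momL i).contDiff.comp_contDiffOn hc

lemma contDiffOn_ent (hc : ContDiffOn ℝ n c S) : ContDiffOn ℝ n (fun y => (c y).ent) S :=
  entL.contDiff.comp_contDiffOn hc

lemma contDiffOn_dfg (hc : ContDiffOn ℝ n c S) (i I : Fin 3) :
    ContDiffOn ℝ n (fun y => (c y).dfg i I) S :=
  (dfgL i I).contDiff.comp_contDiffOn hc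

lemma contDiffOn_pairing (hc : ContDiffOn ℝ n c S) (hd : ContDiffOn ℝ n d S) :
    ContDiffOn ℝ n (fun y => (c y).pairing (d y)) S := by
  unfold pairing
  refine (((contDiffOn_rho hc).mul (contDiffOn_rho hd)).add
    (ContDiffOn.sum fun i _ => (contDiffOn_mom hc i).mul (contDiffOn_mom hd i))).add
    ((contDiffOn_ent hc).mul (contDiffOn_ent hd)) |>.add
    (ContDiffOn.sum fun i _ => ContDiffOn.sum fun I _ =>
      (contDiffOn_dfg hc i I).mul (contDiffOn_dfg hd i I))

end Regularity

lemma continuousOn_pairing {X : Type*} [TopologicalSpace X] {S : Set X} {c d : X → EulerValue}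
    (hc : ContinuousOn c S) (hd : ContinuousOn d S) :
    ContinuousOn (fun y => (c y).pairing (d y)) S := by
  have h : ContDiff ℝ 1 fun p : EulerValue × EulerValue => p.1.pairing p.2 :=
    contDiffOn_univ.1 (contDiffOn_pairing contDiff_fst.contDiffOn contDiff_snd.contDiffOn)
  exact h.continuous.comp_continuousOn (hc.prodMk hd)

end EulerValue

/-! ### Differentiating a functional along a curve of fields -/

/-- The spatial derivatives of a smooth curve of fields, all supported in one compact set, grow at
most linearly in time. -/
lemma exists_iteratedFDeriv_le {E V : Type*} [NormedAddCommGroup E] [NormedSpace ℝ E]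
    [NormedAddCommGroup V] [NormedSpace ℝ V] {J : Set ℝ} (hJ : IsOpen J) {t : ℝ} (ht : t ∈ J)
    {K : Set E} (hK : IsCompact K) {H : ℝ × E → V} (hH : ContDiffOn ℝ ∞ H (J ×ˢ univ))
    (h0 : ∀ τ ∈ J, ∀ y ∉ K, H (τ, y) = 0) (ht0 : ∀ y, H (t, y) = 0) (k : ℕ) :
    ∃ A : ℝ, 0 ≤ A ∧ ∀ᶠ τ in nhds t, ∀ j ≤ k, ∀ y,
      ‖iteratedFDeriv ℝ j (fun z => H (τ, z)) y‖ ≤ A * |τ - t| := by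
  have hJE : IsOpen (J ×ˢ (univ : Set E)) := hJ.prod isOpen_univ
  obtain ⟨r, hr, hrJ⟩ := Metric.nhds_basis_closedBall.mem_iff.1 (hJ.mem_nhds ht)
  have hD : ∀ (j : ℕ), ContDiffOn ℝ 1 (iteratedFDeriv ℝ j H) (J ×ˢ univ) := fun j p hp =>
    ((hH.contDiffAt (hJE.mem_nhds hp)).iteratedFDeriv_right (m := 1) (i := j)
      (by exact_mod_cast le_top)).contDiffWithinAt
  -- A time slice is `H` composed with a translation and the inclusion of space into spacetime, so
  -- its derivatives are those of `H` restricted to spatial directions.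
  have hslice : ∀ (j : ℕ), ∀ τ ∈ J, ∀ y, iteratedFDeriv ℝ j (fun z => H (τ, z)) y
      = (iteratedFDeriv ℝ j H (τ, y)).compContinuousLinearMap
          fun _ => ContinuousLinearMap.inr ℝ ℝ E := by
    intro j τ hτ y
    have e1 : (fun z => H (τ, z)) = (fun p => H ((τ, 0) + p)) ∘ (ContinuousLinearMap.inr ℝ ℝ E) := by
      ext z; simp
    have hsm : ContDiffOn ℝ ∞ (fun p => H ((τ, (0 : E)) + p))
        ((fun p => (τ, (0 : E)) + p) ⁻¹' (J ×ˢ univ)) :=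
      hH.comp (contDiff_const.add contDiff_id).contDiffOn (fun _ h => h)
    have hop : IsOpen ((fun p => (τ, (0 : E)) + p) ⁻¹' (J ×ˢ (univ : Set E))) :=
      hJE.preimage (by fun_prop)
    have hop2 : IsOpen (ContinuousLinearMap.inr ℝ ℝ E ⁻¹'
        ((fun p => (τ, (0 : E)) + p) ⁻¹' (J ×ˢ (univ : Set E)))) :=
      hop.preimage (ContinuousLinearMap.inr ℝ ℝ E).continuous
    have hy1 : ContinuousLinearMap.inr ℝ ℝ E y ∈
        ((fun p => (τ, (0 : E)) + p) ⁻¹' (J ×ˢ (univ : Set E))) := by simpa using hτ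
    rw [e1, ← iteratedFDerivWithin_of_isOpen j hop2 hy1,
      ContinuousLinearMap.iteratedFDerivWithin_comp_right (ContinuousLinearMap.inr ℝ ℝ E) hsm
        hop.uniqueDiffOn hop2.uniqueDiffOn hy1 (i := j) (by exact_mod_cast le_top),
      iteratedFDerivWithin_of_isOpen j hop hy1, iteratedFDeriv_comp_add_left]
    simp
  have hbound : ∀ j : ℕ, ∃ A : ℝ, 0 ≤ A ∧ ∀ τ ∈ Metric.closedBall t r, ∀ y,
      ‖iteratedFDeriv ℝ j (fun z => H (τ, z)) y‖ ≤ A * |τ - t| := by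
    intro j
    have hfd : ContinuousOn (fderiv ℝ (iteratedFDeriv ℝ j H)) (J ×ˢ univ) :=
      (hD j).continuousOn_fderiv_of_isOpen hJE (by simp)
    obtain ⟨A, hA⟩ := ((isCompact_closedBall t r).prod hK).exists_bound_of_continuousOn
      (f := fderiv ℝ (iteratedFDeriv ℝ j H)) (hfd.mono (prod_mono hrJ (subset_univ _)))
    -- The bound supplied by compactness may be negative if `K` is empty, hence `max A 0`. The
    -- product bounds the effect of restricting to spatial directions.
    refine ⟨max A 0 * ‖(1 : ℝ)‖ * ∏ _i : Fin j, ‖ContinuousLinearMap.inr ℝ ℝ E‖, by positivity, ?_⟩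
    intro τ hτ y
    by_cases hy : y ∈ K
    -- Mean value inequality in time on the convex ball; the time derivative is bounded because the
    -- ball times `K` is compact.
    · have hmv : ‖iteratedFDeriv ℝ j H (τ, y) - iteratedFDeriv ℝ j H (t, y)‖
          ≤ max A 0 * ‖τ - t‖ := by
        refine Convex.norm_image_sub_le_of_norm_hasDerivWithin_le
          (f := fun s => iteratedFDeriv ℝ j H (s, y))
          (f' := fun s => fderiv ℝ (iteratedFDeriv ℝ j H) (s, y) (1, 0))
          (s := Metric.closedBall t r) ?_ ?_ (convex_closedBall t r)
          (Metric.mem_closedBall_self hr.le) hτ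
        · intro s hs
          have h1 : HasFDerivAt (iteratedFDeriv ℝ j H)
              (fderiv ℝ (iteratedFDeriv ℝ j H) (s, y)) (s, y) :=
            (((hD j).contDiffAt (hJE.mem_nhds ⟨hrJ hs, mem_univ _⟩)).differentiableAt
              (by simp)).hasFDerivAt
          exact (h1.comp_hasDerivAt s ((hasDerivAt_id s).prodMk (hasDerivAt_const s y))).hasDerivWithinAt
        · intro s hs
          calc _ ≤ ‖fderiv ℝ (iteratedFDeriv ℝ j H) (s, y)‖ * ‖((1 : ℝ), (0 : E))‖ :=
                ContinuousLinearMap.le_opNorm _ _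
            _ ≤ max A 0 * 1 := by
                gcongr
                · exact (hA (s, y) ⟨hs, hy⟩).trans (le_max_left _ _)
                · simp
            _ = max A 0 := mul_one _
      have hz : iteratedFDeriv ℝ j (fun z => H (t, z)) y = 0 := by
        have : (fun z => H (t, z)) = fun _ => (0 : V) := funext ht0
        rw [this]; simp
      have hdiff : iteratedFDeriv ℝ j (fun z => H (τ, z)) y
          = (iteratedFDeriv ℝ j H (τ, y) - iteratedFDeriv ℝ j H (t, y)).compContinuousLinearMap
            fun _ => ContinuousLinearMap.inr ℝ ℝ E := by
        rw [← sub_zero (iteratedFDeriv ℝ j (fun z => H (τ, z)) y), ← hz, hslice j τ (hrJ hτ),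
          hslice j t ht]
        rfl
      rw [hdiff]
      refine (ContinuousMultilinearMap.norm_compContinuousLinearMap_le _ _).trans ?_
      calc _ ≤ (max A 0 * ‖τ - t‖) * ∏ _i : Fin j, ‖ContinuousLinearMap.inr ℝ ℝ E‖ := by gcongr
        _ = _ := by rw [Real.norm_eq_abs, norm_one]; ring
    · have hz : (fun z => H (τ, z)) =ᶠ[nhds y] fun _ => (0 : V) := by
        filter_upwards [hK.isClosed.isOpen_compl.mem_nhds hy] with z hz
        exact h0 τ (hrJ hτ) z hz
      have : iteratedFDeriv ℝ j (fun z => H (τ, z)) y = 0 := by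
        rw [(hz.iteratedFDeriv ℝ j).eq_of_nhds]; simp
      rw [this, norm_zero]; positivity
  choose A hA0 hA using hbound
  refine ⟨∑ j ∈ Finset.range (k + 1), A j, Finset.sum_nonneg fun j _ => hA0 j, ?_⟩
  filter_upwards [Metric.closedBall_mem_nhds t hr] with τ hτ j hj y
  refine (hA j τ hτ y).trans ?_
  gcongr
  exact Finset.single_le_sum (f := A) (fun j _ => hA0 j) (Finset.mem_range.2 (by omega))

/-- Differentiation under the integral of the pairing with a smooth curve of variations supported
in a compact set. -/
lemma hasDerivAt_integral_pairing {Ω : Set Space3} (hΩ : IsOpen Ω) {g : Space3 → EulerValue}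
    (hg : ContDiffOn ℝ ∞ g Ω) {J : Set ℝ} (hJ : IsOpen J) {t : ℝ} (ht : t ∈ J)
    {K : Set Space3} (hK : IsCompact K) (hKΩ : K ⊆ Ω) {H : ℝ × Space3 → EulerValue}
    (hH : ContDiffOn ℝ ∞ H (J ×ˢ univ)) (h0 : ∀ τ ∈ J, ∀ y ∉ K, H (τ, y) = 0) :
    HasDerivAt (fun τ => ∫ y in Ω, (g y).pairing (H (τ, y)))
      (∫ y in Ω, (g y).pairing (fderiv ℝ H (t, y) (1, 0))) t := by
  have hJE : IsOpen (J ×ˢ (univ : Set Space3)) := hJ.prod isOpen_univ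
  obtain ⟨r, hr, hrJ⟩ := Metric.nhds_basis_closedBall.mem_iff.1 (hJ.mem_nhds ht)
  have hgK : ContinuousOn g K := hg.continuousOn.mono hKΩ
  have hfd : ContinuousOn (fun p => fderiv ℝ H p (1, 0)) (J ×ˢ univ) :=
    (hH.continuousOn_fderiv_of_isOpen hJE (by simp)).clm_apply continuousOn_const
  have hHd : ∀ τ ∈ J, ∀ y, HasDerivAt (fun s => H (s, y)) (fderiv ℝ H (τ, y) (1, 0)) τ := by
    intro τ hτ y
    have h1 : HasFDerivAt H (fderiv ℝ H (τ, y)) (τ, y) :=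
      ((hH.contDiffAt (hJE.mem_nhds ⟨hτ, mem_univ _⟩)).differentiableAt (by simp)).hasFDerivAt
    exact h1.comp_hasDerivAt τ ((hasDerivAt_id τ).prodMk (hasDerivAt_const τ y))
  have hout : ∀ τ ∈ J, ∀ y ∉ K, fderiv ℝ H (τ, y) (1, 0) = 0 := by
    intro τ hτ y hy
    refine (hHd τ hτ y).unique ((hasDerivAt_const τ (0 : EulerValue)).congr_of_eventuallyEq ?_)
    filter_upwards [hJ.mem_nhds hτ] with s hs using h0 s hs y hy
  -- The integral is moved to `K`, where `g` is bounded; on `Ω` it need not be.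
  have hred : ∀ f : Space3 → EulerValue, (∀ y ∉ K, f y = 0) →
      ∫ y in Ω, (g y).pairing (f y) = ∫ y in K, (g y).pairing (f y) := by
    intro f hf
    refine (setIntegral_eq_of_subset_of_forall_sdiff_eq_zero hΩ.measurableSet hKΩ ?_)
    intro y hy
    rw [hf y hy.2, EulerValue.pairing_zero_right]
  rw [hred _ (hout t ht)]
  have hslice : ∀ τ ∈ J, MapsTo (fun y : Space3 => (τ, y)) K (J ×ˢ univ) :=
    fun τ hτ y _ => ⟨hτ, mem_univ _⟩
  have hcont : ∀ τ ∈ J, ContinuousOn (fun y => (g y).pairing (H (τ, y))) K := fun τ hτ =>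
    EulerValue.continuousOn_pairing hgK
      (hH.continuousOn.comp (by fun_prop) (hslice τ hτ))
  have hcont2 : ContinuousOn (fun p : ℝ × Space3 => (g p.2).pairing (fderiv ℝ H p (1, 0)))
      (Metric.closedBall t r ×ˢ K) :=
    EulerValue.continuousOn_pairing (hgK.comp continuousOn_snd fun p hp => hp.2)
      (hfd.mono (prod_mono hrJ (subset_univ _)))
  obtain ⟨B, hB⟩ := ((isCompact_closedBall t r).prod hK).exists_bound_of_continuousOn hcont2
  have key := (hasDerivAt_integral_of_dominated_loc_of_deriv_le (μ := volume.restrict K)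
    (F := fun τ y => (g y).pairing (H (τ, y)))
    (F' := fun τ y => (g y).pairing (fderiv ℝ H (τ, y) (1, 0)))
    (bound := fun _ => B) (x₀ := t) (Metric.closedBall_mem_nhds t hr)
    (by filter_upwards [hJ.mem_nhds ht] with τ hτ using
          (hcont τ hτ).aestronglyMeasurable hK.measurableSet)
    ((hcont t ht).integrableOn_compact hK)
    ((hcont2.comp (f := fun y : Space3 => (t, y)) (by fun_prop)
      fun y hy => ⟨Metric.mem_closedBall_self hr.le, hy⟩).aestronglyMeasurable hK.measurableSet)
    (by
      refine (ae_restrict_mem hK.measurableSet).mono fun y hy τ hτ => hB (τ, y) ⟨hτ, hy⟩)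
    (by
      have : IsFiniteMeasure (volume.restrict K) := ⟨by simpa using hK.measure_lt_top⟩
      exact integrable_const B)
    (Filter.Eventually.of_forall fun y τ hτ => by
      have := (g y).pairingL.hasFDerivAt.comp_hasDerivAt τ (hHd τ (hrJ hτ) y)
      simpa [Function.comp_def] using this)).2
  refine key.congr_of_eventuallyEq ?_
  filter_upwards [hJ.mem_nhds ht] with τ hτ using hred _ (h0 τ hτ)

/-- A differentiable functional may be differentiated along a smooth curve of compactly supported
variations. -/
lemma HasFrechetDeriv.hasDerivAt_curve {Ω : Set Space3} (hΩ : IsOpen Ω)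
    {Φ : (Space3 → EulerValue) → ℝ} {q g : Space3 → EulerValue} (hΦ : HasFrechetDeriv Ω Φ q g)
    {J : Set ℝ} (hJ : IsOpen J) {t : ℝ} (ht : t ∈ J)
    {K : Set Space3} (hK : IsCompact K) (hKΩ : K ⊆ Ω) {H : ℝ × Space3 → EulerValue}
    (hH : ContDiffOn ℝ ∞ H (J ×ˢ univ)) (h0 : ∀ τ ∈ J, ∀ y ∉ K, H (τ, y) = 0)
    (ht0 : ∀ y, H (t, y) = 0) :
    HasDerivAt (fun τ => Φ (q + fun y => H (τ, y)))
      (∫ y in Ω, (g y).pairing (fderiv ℝ H (t, y) (1, 0))) t := by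
  obtain ⟨k, hk⟩ := hΦ.diff K hK hKΩ
  obtain ⟨A, hA0, hA⟩ := exists_iteratedFDeriv_le hJ ht hK hH h0 ht0 k
  have hI := hasDerivAt_integral_pairing hΩ hΦ.smooth hJ ht hK hKΩ hH h0
  have hq : (q + fun y => H (t, y)) = q := by ext1 y; simp [ht0]
  have hR : HasDerivAt (fun τ => Φ (q + fun y => H (τ, y)) - Φ q
      - ∫ y in Ω, (g y).pairing (H (τ, y))) 0 t := by
    rw [hasDerivAt_iff_isLittleO, Asymptotics.isLittleO_iff]
    intro ε hε
    -- The variation is measured at scale (A + 1)|τ - t|, so this tolerance makes the error ε|τ -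
    -- t|; the added 1 avoids dividing by zero when A = 0.
    obtain ⟨δ, hδ, hmain⟩ := hk (ε / (A + 1)) (by positivity)
    have hsmall : ∀ᶠ τ in nhds t, (A + 1) * |τ - t| ≤ δ := by
      have : Filter.Tendsto (fun τ => (A + 1) * |τ - t|) (nhds t) (nhds ((A + 1) * |t - t|)) :=
        Continuous.tendsto (by fun_prop) t
      rw [sub_self, abs_zero, mul_zero] at this
      exact (this.eventually (gt_mem_nhds hδ)).mono fun _ h => h.le
    filter_upwards [hA, hsmall, hJ.mem_nhds ht] with τ h1 h2 hτ
    have h3 := hmain (fun y => H (τ, y))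
      (contDiffOn_univ.1 (hH.comp (contDiff_prodMk_right τ).contDiffOn
        fun y _ => ⟨hτ, mem_univ _⟩))
      (closure_minimal (fun y hy => by
        by_contra hyK
        exact hy (h0 τ hτ y hyK)) hK.isClosed)
      ((A + 1) * |τ - t|) h2
      (fun j hj y => (h1 j hj y).trans (by gcongr; linarith))
    rw [hq]
    simp only [ht0, EulerValue.pairing_zero_right, integral_zero, sub_self, sub_zero,
      smul_zero, Real.norm_eq_abs]
    calc _ ≤ ε / (A + 1) * ((A + 1) * |τ - t|) := h3
      _ = ε * |τ - t| := by field_simp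
  have := (hR.add hI).add_const (Φ q)
  rw [zero_add] at this
  refine this.congr_of_eventuallyEq (Filter.Eventually.of_forall fun τ => ?_)
  simp

/-! ### Coordinates and Liouville's formula -/

lemma Space3.sum_single (w : Space3) : ∑ j, w j • EuclideanSpace.single j (1 : ℝ) = w := by
  ext i
  simp [Finset.sum_apply, Pi.single_apply]

lemma Space3.clm_apply_eq_sum {V : Type*} [NormedAddCommGroup V] [NormedSpace ℝ V]
    (B : Space3 →L[ℝ] V) (w : Space3) :
    B w = ∑ j, w j • B (EuclideanSpace.single j 1) := by
  conv_lhs => rw [← Space3.sum_single w]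
  simp [map_sum]

lemma Space3.fderiv_apply_eq_pderiv {u : Space3 → Space3} {y : Space3}
    (hu : DifferentiableAt ℝ u y) (i j : Fin 3) :
    fderiv ℝ u y (EuclideanSpace.single j 1) i = pderiv j (fun z => u z i) y := by
  have := ((EuclideanSpace.proj (𝕜 := ℝ) i).hasFDerivAt (x := u y)).comp y hu.hasFDerivAt
  have h2 : fderiv ℝ (fun z => u z i) y
      = (EuclideanSpace.proj (𝕜 := ℝ) i : Space3 →L[ℝ] ℝ).comp (fderiv ℝ u y) := this.fderiv
  simp [pderiv, h2]

/-- Liouville's formula for the determinant of a linear flow. -/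
lemma Space3.hasDerivAt_det {G : ℝ → Space3 →L[ℝ] Space3} {B : Space3 →L[ℝ] Space3} {t : ℝ}
    (hG : HasDerivAt G (B.comp (G t)) t) :
    HasDerivAt (fun s => (G s).det)
      ((∑ j, B (EuclideanSpace.single j 1) j) * (G t).det) t := by
  have he : ∀ i j : Fin 3, HasDerivAt (fun s => G s (EuclideanSpace.single j 1) i)
      (∑ k, G t (EuclideanSpace.single j 1) k * B (EuclideanSpace.single k 1) i) t := by
    intro i j
    have h1 := hG.clm_apply (hasDerivAt_const t (EuclideanSpace.single j (1 : ℝ)))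
    have h2 := (EuclideanSpace.proj (𝕜 := ℝ) i : Space3 →L[ℝ] ℝ).hasFDerivAt.comp_hasDerivAt t h1
    have h3 := Space3.clm_apply_eq_sum B (G t (EuclideanSpace.single j 1))
    simp only [Function.comp_def, map_zero, add_zero, ContinuousLinearMap.comp_apply, h3] at h2
    simpa using h2
  simp only [Space3.det_eq, Matrix.det_fin_three, Matrix.of_apply]
  refine ((((((((he 0 0).mul (he 1 1)).mul (he 2 2)).sub (((he 0 0).mul (he 1 2)).mul (he 2 1))).sub
    (((he 0 1).mul (he 1 0)).mul (he 2 2))).add (((he 0 1).mul (he 1 2)).mul (he 2 0))).add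
    (((he 0 2).mul (he 1 0)).mul (he 2 1))).sub
    (((he 0 2).mul (he 1 1)).mul (he 2 0))).congr_deriv ?_
  simp only [Fin.sum_univ_three]
  simp only [Pi.mul_apply]
  ring

/-! ### Placements, Eulerian fields at material points, change of variables -/

namespace IsPlacement

variable {Ω₀ Ω : Set Space3} {x : Space3 → Space3}

lemma invFunOn_mem (hx : IsPlacement Ω₀ Ω x) {y : Space3} (hy : y ∈ Ω) :
    Function.invFunOn x Ω₀ y ∈ Ω₀ :=
  Function.invFunOn_mem (by rw [← hx.bijOn.image_eq] at hy; exact hy)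

lemma apply_invFunOn (hx : IsPlacement Ω₀ Ω x) {y : Space3} (hy : y ∈ Ω) :
    x (Function.invFunOn x Ω₀ y) = y :=
  Function.invFunOn_eq (by rw [← hx.bijOn.image_eq] at hy; exact hy)

lemma invFunOn_apply (hx : IsPlacement Ω₀ Ω x) {Z : Space3} (hZ : Z ∈ Ω₀) :
    Function.invFunOn x Ω₀ (x Z) = Z :=
  hx.bijOn.injOn (hx.invFunOn_mem (hx.bijOn.mapsTo hZ)) hZ
    (hx.apply_invFunOn (hx.bijOn.mapsTo hZ))

lemma contDiffAt (hx : IsPlacement Ω₀ Ω x) (hΩ₀ : IsOpen Ω₀) {Z : Space3} (hZ : Z ∈ Ω₀) :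
    ContDiffAt ℝ ∞ x Z := hx.smooth.contDiffAt (hΩ₀.mem_nhds hZ)

lemma differentiableAt (hx : IsPlacement Ω₀ Ω x) (hΩ₀ : IsOpen Ω₀) {Z : Space3} (hZ : Z ∈ Ω₀) :
    DifferentiableAt ℝ x Z := (hx.contDiffAt hΩ₀ hZ).differentiableAt (by simp)

lemma fderiv_injective (hx : IsPlacement Ω₀ Ω x) {Z : Space3} (hZ : Z ∈ Ω₀) :
    Function.Injective (fderiv ℝ x Z) := by
  have h : LinearMap.det (fderiv ℝ x Z : Space3 →ₗ[ℝ] Space3) ≠ 0 := (hx.det_pos Z hZ).ne'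
  exact (LinearMap.equivOfDetNeZero _ h).injective

lemma contDiffAt_invFunOn (hx : IsPlacement Ω₀ Ω x) (hΩ₀ : IsOpen Ω₀) {y : Space3}
    (hy : y ∈ Ω) : ContDiffAt ℝ ∞ (Function.invFunOn x Ω₀) y := by
  have := (_root_.contDiffAt_invFunOn hΩ₀ hx.smooth hx.bijOn.injOn (hx.invFunOn_mem hy)
    (hx.fderiv_injective (hx.invFunOn_mem hy))).2
  rwa [hx.apply_invFunOn hy] at this

lemma contDiffOn_invFunOn (hx : IsPlacement Ω₀ Ω x) (hΩ₀ : IsOpen Ω₀) :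
    ContDiffOn ℝ ∞ (Function.invFunOn x Ω₀) Ω :=
  fun _ hy => (hx.contDiffAt_invFunOn hΩ₀ hy).contDiffWithinAt

/-- The chain rule for X∘x = id, after taking determinants. It lets the Jacobian in the Eulerian
fields be followed along a fixed material point. -/
lemma det_fderiv_invFunOn (hx : IsPlacement Ω₀ Ω x) (hΩ₀ : IsOpen Ω₀) {Z : Space3}
    (hZ : Z ∈ Ω₀) :
    (fderiv ℝ (Function.invFunOn x Ω₀) (x Z)).det = ((fderiv ℝ x Z).det)⁻¹ := by
  have h1 : HasFDerivAt (Function.invFunOn x Ω₀) (fderiv ℝ (Function.invFunOn x Ω₀) (x Z)) (x Z) :=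
    ((hx.contDiffAt_invFunOn hΩ₀ (hx.bijOn.mapsTo hZ)).differentiableAt (by simp)).hasFDerivAt
  have h2 := h1.comp Z (hx.differentiableAt hΩ₀ hZ).hasFDerivAt
  have h3 : HasFDerivAt (Function.invFunOn x Ω₀ ∘ x) (ContinuousLinearMap.id ℝ Space3) Z := by
    refine (hasFDerivAt_id Z).congr_of_eventuallyEq ?_
    filter_upwards [hΩ₀.mem_nhds hZ] with W hW using hx.invFunOn_apply hW
  have h4 := h2.unique h3
  have h5 : (fderiv ℝ (Function.invFunOn x Ω₀) (x Z)).det * (fderiv ℝ x Z).det = 1 := by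
    have := congrArg ContinuousLinearMap.det h4
    simpa [ContinuousLinearMap.det, LinearMap.det_comp] using this
  exact eq_inv_of_mul_eq_one_left h5

/-- The Eulerian fields at the present position of a material point. -/
lemma eulerianFields_apply (hx : IsPlacement Ω₀ Ω x) (hΩ₀ : IsOpen Ω₀) (ρ₀ s₀ : Space3 → ℝ)
    (M : Space3 → Space3) {Z : Space3} (hZ : Z ∈ Ω₀) :
    eulerianFields Ω₀ Ω ρ₀ s₀ x M (x Z)
      = (ρ₀ Z * ((fderiv ℝ x Z).det)⁻¹, ((fderiv ℝ x Z).det)⁻¹ • M Z,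
          s₀ Z * ((fderiv ℝ x Z).det)⁻¹,
          fun i I => fderiv ℝ x Z (EuclideanSpace.single I 1) i) := by
  have hy := hx.bijOn.mapsTo hZ
  simp only [eulerianFields, indicator_of_mem hy, hx.invFunOn_apply hZ,
    hx.det_fderiv_invFunOn hΩ₀ hZ]

/-- Change of variables from the Eulerian to the Lagrangian frame. -/
lemma setIntegral_eq (hx : IsPlacement Ω₀ Ω x) (hΩ₀ : IsOpen Ω₀) (g : Space3 → ℝ) :
    ∫ y in Ω, g y = ∫ Z in Ω₀, (fderiv ℝ x Z).det * g (x Z) := by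
  rw [← hx.bijOn.image_eq, integral_image_eq_integral_abs_det_fderiv_smul volume
    hΩ₀.measurableSet (fun Z hZ => (hx.differentiableAt hΩ₀ hZ).hasFDerivAt.hasFDerivWithinAt)
    hx.bijOn.injOn]
  refine setIntegral_congr_fun hΩ₀.measurableSet fun Z hZ => ?_
  simp only [smul_eq_mul, abs_of_pos (hx.det_pos Z hZ)]

lemma integrableOn_iff (hx : IsPlacement Ω₀ Ω x) (hΩ₀ : IsOpen Ω₀) (g : Space3 → ℝ) :
    IntegrableOn g Ω ↔ IntegrableOn (fun Z => (fderiv ℝ x Z).det * g (x Z)) Ω₀ := by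
  rw [← hx.bijOn.image_eq, integrableOn_image_iff_integrableOn_abs_det_fderiv_smul volume
    hΩ₀.measurableSet (fun Z hZ => (hx.differentiableAt hΩ₀ hZ).hasFDerivAt.hasFDerivWithinAt)
    hx.bijOn.injOn]
  refine integrableOn_congr_fun (fun Z hZ => ?_) hΩ₀.measurableSet
  simp only [smul_eq_mul, abs_of_pos (hx.det_pos Z hZ)]

end IsPlacement

/-! ### Smooth motions: joint regularity in time and space -/

/-- A smooth family of Lagrangian states, with times in `J`. -/
structure IsSmoothMotion (Ω₀ Ω : Set Space3) (J : Set ℝ) (x M : ℝ → Space3 → Space3) : Prop where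
  placement : ∀ t ∈ J, IsPlacement Ω₀ Ω (x t)
  smooth_x : ContDiffOn ℝ ∞ (fun p : ℝ × Space3 => x p.1 p.2) (J ×ˢ Ω₀)
  smooth_M : ContDiffOn ℝ ∞ (fun p : ℝ × Space3 => M p.1 p.2) (J ×ˢ Ω₀)

namespace IsSmoothMotion

variable {Ω₀ Ω : Set Space3} {J : Set ℝ} {x M : ℝ → Space3 → Space3}

lemma hasFDerivAt_x (h : IsSmoothMotion Ω₀ Ω J x M) (hΩ₀ : IsOpen Ω₀) (hJ : IsOpen J)
    {t : ℝ} (ht : t ∈ J) {Z : Space3} (hZ : Z ∈ Ω₀) :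
    HasFDerivAt (fun p : ℝ × Space3 => x p.1 p.2)
      (fderiv ℝ (fun p : ℝ × Space3 => x p.1 p.2) (t, Z)) (t, Z) :=
  ((h.smooth_x.contDiffAt ((hJ.prod hΩ₀).mem_nhds ⟨ht, hZ⟩)).differentiableAt
    (by simp)).hasFDerivAt

/-- Smoothness is assumed jointly in (t, X); this transfers it to the deformation gradient at each
time. -/
lemma fderiv_slice (h : IsSmoothMotion Ω₀ Ω J x M) (hΩ₀ : IsOpen Ω₀) (hJ : IsOpen J)
    {t : ℝ} (ht : t ∈ J) {Z : Space3} (hZ : Z ∈ Ω₀) :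
    fderiv ℝ (x t) Z = (fderiv ℝ (fun p : ℝ × Space3 => x p.1 p.2) (t, Z)).comp
      (ContinuousLinearMap.inr ℝ ℝ Space3) :=
  ((h.hasFDerivAt_x hΩ₀ hJ ht hZ).comp Z (hasFDerivAt_prodMk_right t Z)).fderiv

/-- The inverse placements are smooth in time and space. -/
lemma contDiffOn_invFunOn (h : IsSmoothMotion Ω₀ Ω J x M) (hΩ₀ : IsOpen Ω₀) (hΩ : IsOpen Ω)
    (hJ : IsOpen J) :
    ContDiffOn ℝ ∞ (fun p : ℝ × Space3 => Function.invFunOn (x p.1) Ω₀ p.2) (J ×ˢ Ω) := by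
  rintro ⟨t, y⟩ ⟨ht, hy⟩
  refine ContDiffAt.contDiffWithinAt ?_
  -- Adjoining time as a coordinate makes the family of inverses a single inverse map in spacetime.
  -- The derivative of Φ is block triangular with blocks 1 and ∂x/∂X, hence injective.
  set Φ : ℝ × Space3 → ℝ × Space3 := fun p => (p.1, x p.1 p.2) with hΦ
  have hop := hJ.prod hΩ₀
  have hinj : InjOn Φ (J ×ˢ Ω₀) := by
    rintro ⟨s, Z⟩ ⟨hs, hZ⟩ ⟨s', Z'⟩ ⟨hs', hZ'⟩ he
    obtain ⟨rfl, he2⟩ := Prod.mk.inj he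
    exact Prod.ext rfl ((h.placement s hs).bijOn.injOn hZ hZ' he2)
  have hsm : ContDiffOn ℝ ∞ Φ (J ×ˢ Ω₀) := contDiff_fst.contDiffOn.prodMk h.smooth_x
  have hp := h.placement t ht
  set Z := Function.invFunOn (x t) Ω₀ y with hZdef
  have hZ : Z ∈ Ω₀ := hp.invFunOn_mem hy
  have hd : HasFDerivAt Φ ((ContinuousLinearMap.fst ℝ ℝ Space3).prod
      (fderiv ℝ (fun p : ℝ × Space3 => x p.1 p.2) (t, Z))) (t, Z) :=
    hasFDerivAt_fst.prodMk (h.hasFDerivAt_x hΩ₀ hJ ht hZ)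
  have hdi : Function.Injective (fderiv ℝ Φ (t, Z)) := by
    rw [hd.fderiv, injective_iff_map_eq_zero]
    rintro ⟨a, w⟩ haw
    obtain ⟨rfl, h2⟩ : a = 0 ∧ fderiv ℝ (fun p : ℝ × Space3 => x p.1 p.2) (t, Z) (a, w) = 0 := by
      simpa using haw
    have h3 : fderiv ℝ (x t) Z w = 0 := by
      rw [h.fderiv_slice hΩ₀ hJ ht hZ]; simpa using h2
    rw [(injective_iff_map_eq_zero _).1 (hp.fderiv_injective hZ) w h3]
    rfl
  have key := (_root_.contDiffAt_invFunOn hop hsm hinj (a := (t, Z)) ⟨ht, hZ⟩ hdi).2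
  have hΦZ : Φ (t, Z) = (t, y) := by simp [hΦ, hZdef, hp.apply_invFunOn hy]
  rw [hΦZ] at key
  refine (contDiff_snd.contDiffAt.comp (t, y) key).congr_of_eventuallyEq ?_
  filter_upwards [(hJ.prod hΩ).mem_nhds ⟨ht, hy⟩]
  rintro ⟨s, z⟩ ⟨hs, hz⟩
  have hps := h.placement s hs
  have hpre : (s, Function.invFunOn (x s) Ω₀ z) ∈ J ×ˢ Ω₀ := ⟨hs, hps.invFunOn_mem hz⟩
  have himg : Φ (s, Function.invFunOn (x s) Ω₀ z) = (s, z) := by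
    simp [hΦ, hps.apply_invFunOn hz]
  have hmem : (s, z) ∈ Φ '' (J ×ˢ Ω₀) := ⟨_, hpre, himg⟩
  have := hinj (Function.invFunOn_mem hmem) hpre ((Function.invFunOn_eq hmem).trans himg.symm)
  simp [Function.comp, this]

/-- The Eulerian fields of a smooth motion are smooth in time and space. -/
lemma contDiffOn_eulerianFields (h : IsSmoothMotion Ω₀ Ω J x M) (hΩ₀ : IsOpen Ω₀)
    (hΩ : IsOpen Ω) (hJ : IsOpen J) {ρ₀ s₀ : Space3 → ℝ} (hρ₀ : ContDiffOn ℝ ∞ ρ₀ Ω₀)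
    (hs₀ : ContDiffOn ℝ ∞ s₀ Ω₀) :
    ContDiffOn ℝ ∞ (fun p : ℝ × Space3 => eulerianFields Ω₀ Ω ρ₀ s₀ (x p.1) (M p.1) p.2)
      (J ×ˢ Ω) := by
  have hY := h.contDiffOn_invFunOn hΩ₀ hΩ hJ
  have hmaps : MapsTo (fun p : ℝ × Space3 => (p.1, Function.invFunOn (x p.1) Ω₀ p.2))
      (J ×ˢ Ω) (J ×ˢ Ω₀) := fun p hp => ⟨hp.1, (h.placement p.1 hp.1).invFunOn_mem hp.2⟩
  have hmaps2 : MapsTo (fun p : ℝ × Space3 => Function.invFunOn (x p.1) Ω₀ p.2)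
      (J ×ˢ Ω) Ω₀ := fun p hp => (hmaps hp).2
  have hYp : ContDiffOn ℝ ∞ (fun p : ℝ × Space3 => (p.1, Function.invFunOn (x p.1) Ω₀ p.2))
      (J ×ˢ Ω) := contDiff_fst.contDiffOn.prodMk hY
  have hG : ContDiffOn ℝ ∞ (fun p : ℝ × Space3 =>
      fderiv ℝ (x p.1) (Function.invFunOn (x p.1) Ω₀ p.2)) (J ×ˢ Ω) := by
    have h1 := ((h.smooth_x.fderiv_of_isOpen (hJ.prod hΩ₀) (m := ∞) (by simp)).comp hYp
      hmaps).clm_comp (contDiffOn_const (c := ContinuousLinearMap.inr ℝ ℝ Space3))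
    refine h1.congr fun p hp => ?_
    exact h.fderiv_slice hΩ₀ hJ hp.1 (hmaps2 hp)
  have hj : ContDiffOn ℝ ∞ (fun p : ℝ × Space3 =>
      ((fderiv ℝ (x p.1) (Function.invFunOn (x p.1) Ω₀ p.2)).det)⁻¹) (J ×ˢ Ω) :=
    (Space3.contDiff_det.comp_contDiffOn hG).inv fun p hp =>
      ((h.placement p.1 hp.1).det_pos _ (hmaps2 hp)).ne'
  have hF : ContDiffOn ℝ ∞ (fun p : ℝ × Space3 => fun i I : Fin 3 =>
      fderiv ℝ (x p.1) (Function.invFunOn (x p.1) Ω₀ p.2) (EuclideanSpace.single I 1) i)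
      (J ×ˢ Ω) := by
    refine contDiffOn_pi.2 fun i => contDiffOn_pi.2 fun I => ?_
    exact (EuclideanSpace.proj (𝕜 := ℝ) i : Space3 →L[ℝ] ℝ).contDiff.comp_contDiffOn
      (hG.clm_apply contDiffOn_const)
  refine (((hρ₀.comp hY hmaps2).mul hj).prodMk ((hj.smul (h.smooth_M.comp hYp hmaps)).prodMk
    (((hs₀.comp hY hmaps2).mul hj).prodMk hF))).congr fun p hp => ?_
  have hp1 := h.placement p.1 hp.1
  have := hp1.eulerianFields_apply hΩ₀ ρ₀ s₀ (M p.1) (hmaps2 hp)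
  rw [hp1.apply_invFunOn hp.2] at this
  exact this

/-- The deformation gradient of a material point is stretched by the velocity gradient. -/
lemma hasDerivAt_fderiv (h : IsSmoothMotion Ω₀ Ω J x M) (hΩ₀ : IsOpen Ω₀) (hΩ : IsOpen Ω)
    (hJ : IsOpen J) {t : ℝ} (ht : t ∈ J) {v : Space3 → Space3} (hvs : ContDiffOn ℝ ∞ v Ω)
    (hv : ∀ Z ∈ Ω₀, HasDerivAt (fun s => x s Z) (v (x t Z)) t) {Z : Space3} (hZ : Z ∈ Ω₀) :
    HasDerivAt (fun s => fderiv ℝ (x s) Z) ((fderiv ℝ v (x t Z)).comp (fderiv ℝ (x t) Z)) t := by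
  set f : ℝ × Space3 → Space3 := fun p => x p.1 p.2 with hf
  have hfat : ContDiffAt ℝ ∞ f (t, Z) :=
    h.smooth_x.contDiffAt ((hJ.prod hΩ₀).mem_nhds ⟨ht, hZ⟩)
  have hf2 : HasFDerivAt (fderiv ℝ f) (fderiv ℝ (fderiv ℝ f) (t, Z)) (t, Z) :=
    ((hfat.fderiv_right (m := 1) (by norm_cast)).differentiableAt (by simp)).hasFDerivAt
  -- Exchanging ∂ₜ and ∂_X turns the rate of the deformation gradient into the X-derivative of v(x),
  -- which the chain rule evaluates.
  have hsymm : IsSymmSndFDerivAt ℝ f (t, Z) := hfat.isSymmSndFDerivAt (by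
    rw [minSmoothness_of_isRCLikeNormedField]
    exact WithTop.coe_le_coe.2 (le_top : (2 : ℕ∞) ≤ ⊤))
  have h1 : HasDerivAt (fun s => (fderiv ℝ f (s, Z)).comp (ContinuousLinearMap.inr ℝ ℝ Space3))
      ((fderiv ℝ (fderiv ℝ f) (t, Z) (1, 0)).comp (ContinuousLinearMap.inr ℝ ℝ Space3)) t := by
    have ha := hf2.comp_hasDerivAt t ((hasDerivAt_id t).prodMk (hasDerivAt_const t Z))
    have hb := ha.clm_comp (hasDerivAt_const t (ContinuousLinearMap.inr ℝ ℝ Space3))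
    simpa using hb
  have h2 : HasDerivAt (fun s => fderiv ℝ (x s) Z)
      ((fderiv ℝ (fderiv ℝ f) (t, Z) (1, 0)).comp (ContinuousLinearMap.inr ℝ ℝ Space3)) t := by
    refine h1.congr_of_eventuallyEq ?_
    filter_upwards [hJ.mem_nhds ht] with s hs using h.fderiv_slice hΩ₀ hJ hs hZ
  refine h2.congr_deriv ?_
  have hvx : HasFDerivAt (fun W => v (x t W)) ((fderiv ℝ v (x t Z)).comp (fderiv ℝ (x t) Z)) Z := by
    have hy := (h.placement t ht).bijOn.mapsTo hZ
    exact ((hvs.contDiffAt (hΩ.mem_nhds hy)).differentiableAt (by simp)).hasFDerivAt.comp Z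
      ((h.placement t ht).differentiableAt hΩ₀ hZ).hasFDerivAt
  have hvt : HasFDerivAt (fun W => fderiv ℝ f (t, W) (1, 0))
      ((fderiv ℝ v (x t Z)).comp (fderiv ℝ (x t) Z)) Z := by
    refine hvx.congr_of_eventuallyEq ?_
    filter_upwards [hΩ₀.mem_nhds hZ] with W hW
    have ha := (h.hasFDerivAt_x hΩ₀ hJ ht hW).comp_hasDerivAt t
      ((hasDerivAt_id t).prodMk (hasDerivAt_const t W))
    exact ha.unique (hv W hW)
  have hvt2 : HasFDerivAt (fun W => fderiv ℝ f (t, W) (1, 0))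
      (((fderiv ℝ (fderiv ℝ f) (t, Z)).comp (ContinuousLinearMap.inr ℝ ℝ Space3)).flip (1, 0)) Z := by
    have ha := hf2.comp Z (hasFDerivAt_prodMk_right t Z)
    have hb := ha.clm_apply (hasFDerivAt_const ((1 : ℝ), (0 : Space3)) Z)
    simpa using hb
  rw [hvt.unique hvt2]
  ext1 w
  simpa using hsymm.eq (1, 0) (0, w)

end IsSmoothMotion

/-! ### Partial derivatives and the transport equations -/

section PartialDerivatives

variable {f g : Space3 → ℝ} {y : Space3}

lemma pderiv_add (hf : DifferentiableAt ℝ f y) (hg : DifferentiableAt ℝ g y) (i : Fin 3) :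
    pderiv i (fun z => f z + g z) y = pderiv i f y + pderiv i g y := by
  simp [pderiv, fderiv_fun_add hf hg]

lemma pderiv_sub (hf : DifferentiableAt ℝ f y) (hg : DifferentiableAt ℝ g y) (i : Fin 3) :
    pderiv i (fun z => f z - g z) y = pderiv i f y - pderiv i g y := by
  simp [pderiv, fderiv_fun_sub hf hg]

lemma pderiv_mul (hf : DifferentiableAt ℝ f y) (hg : DifferentiableAt ℝ g y) (i : Fin 3) :
    pderiv i (fun z => f z * g z) y = f y * pderiv i g y + g y * pderiv i f y := by
  simp [pderiv, fderiv_fun_mul hf hg]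

lemma pderiv_sum {ι : Type*} {s : Finset ι} {f : ι → Space3 → ℝ}
    (hf : ∀ k ∈ s, DifferentiableAt ℝ (f k) y) (i : Fin 3) :
    pderiv i (fun z => ∑ k ∈ s, f k z) y = ∑ k ∈ s, pderiv i (f k) y := by
  simp [pderiv, fderiv_fun_sum hf]

lemma pderiv_congr (h : f =ᶠ[nhds y] g) (i : Fin 3) : pderiv i f y = pderiv i g y := by
  simp [pderiv, h.fderiv_eq]

lemma contDiffOn_pderiv {Ω : Set Space3} (hΩ : IsOpen Ω) (hf : ContDiffOn ℝ ∞ f Ω) (i : Fin 3) :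
    ContDiffOn ℝ ∞ (pderiv i f) Ω :=
  (hf.fderiv_of_isOpen hΩ (m := ∞) (by simp)).clm_apply contDiffOn_const

lemma contDiffOn_coord {X : Type*} [NormedAddCommGroup X] [NormedSpace ℝ X] {S : Set X}
    {n : WithTop ℕ∞} {v : X → Space3} (hv : ContDiffOn ℝ n v S) (i : Fin 3) :
    ContDiffOn ℝ n (fun z => v z i) S :=
  (EuclideanSpace.proj (𝕜 := ℝ) i : Space3 →L[ℝ] ℝ).contDiff.comp_contDiffOn hv

end PartialDerivatives

/-- `a` is the rate of change at `y` of the Eulerian fields `q` that are carried along by the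
velocity field `v`, while `P` is the force density. -/
structure IsTransport (q : Space3 → EulerValue) (v P : Space3 → Space3) (y : Space3)
    (a : EulerValue) : Prop where
  rho : a.rho = -(∑ j, pderiv j (fun z => v z j) y) * (q y).rho
    - ∑ k, v y k * pderiv k (fun z => (q z).rho) y
  mom : ∀ i, a.mom i = P y i - (∑ j, pderiv j (fun z => v z j) y) * (q y).mom i
    - ∑ k, v y k * pderiv k (fun z => (q z).mom i) y
  ent : a.ent = -(∑ j, pderiv j (fun z => v z j) y) * (q y).ent
    - ∑ k, v y k * pderiv k (fun z => (q z).ent) y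
  dfg : ∀ i I, a.dfg i I = (∑ j, pderiv j (fun z => v z i) y * (q y).dfg j I)
    - ∑ k, v y k * pderiv k (fun z => (q z).dfg i I) y

namespace IsSmoothMotion

variable {Ω₀ Ω : Set Space3} {J : Set ℝ} {x M : ℝ → Space3 → Space3}

/-- The Eulerian fields of a smooth motion are transported by its velocity field. -/
lemma isTransport (h : IsSmoothMotion Ω₀ Ω J x M) (hΩ₀ : IsOpen Ω₀) (hΩ : IsOpen Ω)
    (hJ : IsOpen J) {ρ₀ s₀ : Space3 → ℝ} (hρ₀ : ContDiffOn ℝ ∞ ρ₀ Ω₀)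
    (hs₀ : ContDiffOn ℝ ∞ s₀ Ω₀) {t : ℝ} (ht : t ∈ J) {v P : Space3 → Space3}
    (hvs : ContDiffOn ℝ ∞ v Ω)
    (hv : ∀ Z ∈ Ω₀, HasDerivAt (fun s => x s Z) (v (x t Z)) t)
    (hP : ∀ Z ∈ Ω₀, HasDerivAt (fun s => M s Z) ((fderiv ℝ (x t) Z).det • P (x t Z)) t)
    {y : Space3} (hy : y ∈ Ω) :
    IsTransport (eulerianFields Ω₀ Ω ρ₀ s₀ (x t) (M t)) v P y
      (fderiv ℝ (fun p : ℝ × Space3 => eulerianFields Ω₀ Ω ρ₀ s₀ (x p.1) (M p.1) p.2)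
        (t, y) (1, 0)) := by
  have hp := h.placement t ht
  obtain ⟨Z, hZ, rfl⟩ : ∃ Z ∈ Ω₀, x t Z = y := ⟨_, hp.invFunOn_mem hy, hp.apply_invFunOn hy⟩
  set Q : ℝ × Space3 → EulerValue :=
    fun p => eulerianFields Ω₀ Ω ρ₀ s₀ (x p.1) (M p.1) p.2 with hQdef
  set q := eulerianFields Ω₀ Ω ρ₀ s₀ (x t) (M t) with hqdef
  have hQ : HasFDerivAt Q (fderiv ℝ Q (t, x t Z)) (t, x t Z) :=
    (((h.contDiffOn_eulerianFields hΩ₀ hΩ hJ hρ₀ hs₀).contDiffAt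
      ((hJ.prod hΩ).mem_nhds ⟨ht, hy⟩)).differentiableAt (by simp)).hasFDerivAt
  have hq : HasFDerivAt q ((fderiv ℝ Q (t, x t Z)).comp (ContinuousLinearMap.inr ℝ ℝ Space3))
      (x t Z) := hQ.comp (x t Z) (hasFDerivAt_prodMk_right t (x t Z))
  have hmat : HasDerivAt (fun s => Q (s, x s Z)) (fderiv ℝ Q (t, x t Z) (1, v (x t Z))) t :=
    hQ.comp_hasDerivAt_of_eq t ((hasDerivAt_id t).prodMk (hv Z hZ)) rfl
  -- The material rate is the Eulerian rate plus v·∂. Thus each component only needs its rate at a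
  -- fixed material point, where the fields are explicit.
  have hgen : ∀ (ℓ : EulerValue →L[ℝ] ℝ) (r : ℝ), HasDerivAt (fun s => ℓ (Q (s, x s Z))) r t →
      ℓ (fderiv ℝ Q (t, x t Z) (1, 0))
        = r - ∑ k, v (x t Z) k * pderiv k (fun z => ℓ (q z)) (x t Z) := by
    intro ℓ r hr
    have h1 : HasDerivAt (fun s => ℓ (Q (s, x s Z)))
        (ℓ (fderiv ℝ Q (t, x t Z) (1, v (x t Z)))) t := ℓ.hasFDerivAt.comp_hasDerivAt t hmat
    have h2 : ((1 : ℝ), v (x t Z)) = (1, 0) + ContinuousLinearMap.inr ℝ ℝ Space3 (v (x t Z)) := by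
      simp
    have h3 : fderiv ℝ (fun z => ℓ (q z)) (x t Z)
        = ℓ.comp ((fderiv ℝ Q (t, x t Z)).comp (ContinuousLinearMap.inr ℝ ℝ Space3)) :=
      (ℓ.hasFDerivAt.comp (x t Z) hq).fderiv
    have h4 := Space3.clm_apply_eq_sum (fderiv ℝ (fun z => ℓ (q z)) (x t Z)) (v (x t Z))
    rw [hr.unique h1, h2, map_add, map_add]
    simp only [pderiv]
    simp only [smul_eq_mul] at h4
    rw [← h4, h3]
    simp
  have hG := h.hasDerivAt_fderiv hΩ₀ hΩ hJ ht hvs hv hZ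
  have hvd : DifferentiableAt ℝ v (x t Z) :=
    (hvs.contDiffAt (hΩ.mem_nhds hy)).differentiableAt (by simp)
  have hdet : (fderiv ℝ (x t) Z).det ≠ 0 := (hp.det_pos Z hZ).ne'
  have hdiv : ∑ j, fderiv ℝ v (x t Z) (EuclideanSpace.single j 1) j
      = ∑ j, pderiv j (fun z => v z j) (x t Z) :=
    Finset.sum_congr rfl fun j _ => Space3.fderiv_apply_eq_pderiv hvd j j
  -- By Liouville's formula the inverse Jacobian decays at the rate div v; this is the source of the
  -- divergence term for all three densities.
  have hinv : HasDerivAt (fun s => ((fderiv ℝ (x s) Z).det)⁻¹)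
      (-(∑ j, pderiv j (fun z => v z j) (x t Z)) * ((fderiv ℝ (x t) Z).det)⁻¹) t := by
    refine ((Space3.hasDerivAt_det hG).inv hdet).congr_deriv ?_
    rw [hdiv]
    field_simp
  have hval : ∀ᶠ s in nhds t, Q (s, x s Z)
      = (ρ₀ Z * ((fderiv ℝ (x s) Z).det)⁻¹, ((fderiv ℝ (x s) Z).det)⁻¹ • M s Z,
          s₀ Z * ((fderiv ℝ (x s) Z).det)⁻¹,
          fun i I => fderiv ℝ (x s) Z (EuclideanSpace.single I 1) i) := by
    filter_upwards [hJ.mem_nhds ht] with s hs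
    exact (h.placement s hs).eulerianFields_apply hΩ₀ ρ₀ s₀ (M s) hZ
  have hqv := hval.self_of_nhds
  have hqv' : q (x t Z) = _ := hqv
  refine ⟨?_, fun i => ?_, ?_, fun i I => ?_⟩
  · refine hgen EulerValue.rhoL _ (((hinv.const_mul (ρ₀ Z)).congr_of_eventuallyEq ?_).congr_deriv ?_)
    · filter_upwards [hval] with s hs
      rw [hs]; rfl
    · rw [hqv']; simp only [EulerValue.rho]; ring
  · have hMi : HasDerivAt (fun s => M s Z i) ((fderiv ℝ (x t) Z).det * P (x t Z) i) t :=
      (EuclideanSpace.proj (𝕜 := ℝ) i : Space3 →L[ℝ] ℝ).hasFDerivAt.comp_hasDerivAt t (hP Z hZ)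
    refine hgen (EulerValue.momL i) _ (((hinv.mul hMi).congr_of_eventuallyEq ?_).congr_deriv ?_)
    · filter_upwards [hval] with s hs
      rw [hs]; rfl
    · rw [hqv']; simp only [EulerValue.mom, PiLp.smul_apply, smul_eq_mul]; field_simp; ring
  · refine hgen EulerValue.entL _ (((hinv.const_mul (s₀ Z)).congr_of_eventuallyEq ?_).congr_deriv ?_)
    · filter_upwards [hval] with s hs
      rw [hs]; rfl
    · rw [hqv']; simp only [EulerValue.ent]; ring
  · have h1 := hG.clm_apply (hasDerivAt_const t (EuclideanSpace.single I (1 : ℝ)))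
    have h2 := (EuclideanSpace.proj (𝕜 := ℝ) i : Space3 →L[ℝ] ℝ).hasFDerivAt.comp_hasDerivAt t h1
    refine hgen (EulerValue.dfgL i I) _ ((h2.congr_of_eventuallyEq ?_).congr_deriv ?_)
    · filter_upwards [hval] with s hs
      rw [hs]; rfl
    · rw [hqv', map_zero, add_zero, ContinuousLinearMap.comp_apply,
        Space3.clm_apply_eq_sum (fderiv ℝ v (x t Z))]
      simp only [EulerValue.dfg, map_sum, map_smul, smul_eq_mul, EuclideanSpace.coe_proj,
        Space3.fderiv_apply_eq_pderiv hvd]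
      exact Finset.sum_congr rfl fun j _ => mul_comm _ _

end IsSmoothMotion

/-! ### Stress, force, and the two divergence identities -/

noncomputable section

/-- The stress `C_{F^i_I} F^j_I` of a functional with functional derivative `c`. -/
def stress (q c : Space3 → EulerValue) (i j : Fin 3) (y : Space3) : ℝ :=
  ∑ I, (c y).dfg i I * (q y).dfg j I

/-- Minus the functional derivative with respect to the placement, per unit volume of the region
occupied, of a functional of the Eulerian fields with functional derivative `c` at `q`. -/
def force (q c : Space3 → EulerValue) (y : Space3) (i : Fin 3) : ℝ :=
  (q y).rho * pderiv i (fun z => (c z).rho) y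
    + (∑ k, (q y).mom k * pderiv i (fun z => (c z).mom k) y)
    + (q y).ent * pderiv i (fun z => (c z).ent) y
    - (∑ j, pderiv j (stress q c i j) y)
    - ∑ k, ∑ I, (c y).dfg k I * pderiv i (fun z => (q z).dfg k I) y

/-- The flux in the integration by parts that moves the derivatives off the velocity. -/
def transportFlux (q c : Space3 → EulerValue) (v : Space3 → Space3) (j : Fin 3) (y : Space3) : ℝ :=
  ((c y).rho * (q y).rho + (∑ k, (c y).mom k * (q y).mom k) + (c y).ent * (q y).ent) * v y j
    - ∑ i, stress q c i j y * v y i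

/-- The flux by which the Lagrangian and the Eulerian bracket densities differ. -/
def bracketFlux (q c d : Space3 → EulerValue) (j : Fin 3) (y : Space3) : ℝ :=
  ∑ i, (stress q c i j y * (d y).mom i - stress q d i j y * (c y).mom i)

end

section Densities

variable {Ω : Set Space3} {q c d : Space3 → EulerValue} {v P : Space3 → Space3}

lemma contDiffOn_stress (hq : ContDiffOn ℝ ∞ q Ω) (hc : ContDiffOn ℝ ∞ c Ω) (i j : Fin 3) :
    ContDiffOn ℝ ∞ (stress q c i j) Ω :=
  ContDiffOn.sum fun I _ =>
    (EulerValue.contDiffOn_dfg hc i I).mul (EulerValue.contDiffOn_dfg hq j I)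

lemma contDiffOn_force (hΩ : IsOpen Ω) (hq : ContDiffOn ℝ ∞ q Ω) (hc : ContDiffOn ℝ ∞ c Ω)
    (i : Fin 3) : ContDiffOn ℝ ∞ (fun y => force q c y i) Ω := by
  refine (((((EulerValue.contDiffOn_rho hq).mul
    (contDiffOn_pderiv hΩ (EulerValue.contDiffOn_rho hc) i)).add
    (ContDiffOn.sum fun k _ => (EulerValue.contDiffOn_mom hq k).mul
      (contDiffOn_pderiv hΩ (EulerValue.contDiffOn_mom hc k) i))).add
    ((EulerValue.contDiffOn_ent hq).mul
      (contDiffOn_pderiv hΩ (EulerValue.contDiffOn_ent hc) i))).sub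
    (ContDiffOn.sum fun j _ => contDiffOn_pderiv hΩ (contDiffOn_stress hq hc i j) j)).sub
    (ContDiffOn.sum fun k _ => ContDiffOn.sum fun I _ => (EulerValue.contDiffOn_dfg hc k I).mul
      (contDiffOn_pderiv hΩ (EulerValue.contDiffOn_dfg hq k I) i))

lemma contDiffOn_transportFlux (hq : ContDiffOn ℝ ∞ q Ω) (hc : ContDiffOn ℝ ∞ c Ω)
    (hv : ContDiffOn ℝ ∞ v Ω) (j : Fin 3) : ContDiffOn ℝ ∞ (transportFlux q c v j) Ω :=
  (((((EulerValue.contDiffOn_rho hc).mul (EulerValue.contDiffOn_rho hq)).add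
    (ContDiffOn.sum fun k _ => (EulerValue.contDiffOn_mom hc k).mul
      (EulerValue.contDiffOn_mom hq k))).add
    ((EulerValue.contDiffOn_ent hc).mul (EulerValue.contDiffOn_ent hq))).mul
    (contDiffOn_coord hv j)).sub
    (ContDiffOn.sum fun i _ => (contDiffOn_stress hq hc i j).mul (contDiffOn_coord hv i))

lemma contDiffOn_bracketFlux (hq : ContDiffOn ℝ ∞ q Ω) (hc : ContDiffOn ℝ ∞ c Ω)
    (hd : ContDiffOn ℝ ∞ d Ω) (j : Fin 3) : ContDiffOn ℝ ∞ (bracketFlux q c d j) Ω :=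
  ContDiffOn.sum fun i _ =>
    ((contDiffOn_stress hq hc i j).mul (EulerValue.contDiffOn_mom hd i)).sub
      ((contDiffOn_stress hq hd i j).mul (EulerValue.contDiffOn_mom hc i))

/-- Pointwise integration by parts for the rate of change of a functional. -/
lemma pairing_eq_of_isTransport (hΩ : IsOpen Ω) (hq : ContDiffOn ℝ ∞ q Ω)
    (hc : ContDiffOn ℝ ∞ c Ω) (hv : ContDiffOn ℝ ∞ v Ω) {y : Space3} (hy : y ∈ Ω)
    {a : EulerValue} (ha : IsTransport q v P y a) :
    (c y).pairing a = (∑ i, force q c y i * v y i) + (∑ i, (c y).mom i * P y i)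
      - ∑ j, pderiv j (transportFlux q c v j) y := by
  have D : ∀ {f : Space3 → ℝ}, ContDiffOn ℝ ∞ f Ω → DifferentiableAt ℝ f y := fun hf =>
    (hf.contDiffAt (hΩ.mem_nhds hy)).differentiableAt (by simp)
  have hcr := D (EulerValue.contDiffOn_rho hc)
  have hqr := D (EulerValue.contDiffOn_rho hq)
  have hcm := fun i => D (EulerValue.contDiffOn_mom hc i)
  have hqm := fun i => D (EulerValue.contDiffOn_mom hq i)
  have hce := D (EulerValue.contDiffOn_ent hc)
  have hqe := D (EulerValue.contDiffOn_ent hq)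
  have hvj := fun j => D (contDiffOn_coord hv j)
  have hS := fun i j => D (contDiffOn_stress hq hc i j)
  have hsum : DifferentiableAt ℝ (fun z => ∑ k, (c z).mom k * (q z).mom k) y :=
    DifferentiableAt.fun_sum fun k _ => (hcm k).fun_mul (hqm k)
  have hflux : ∀ j, pderiv j (transportFlux q c v j) y =
      ((c y).rho * (q y).rho + (∑ k, (c y).mom k * (q y).mom k) + (c y).ent * (q y).ent)
          * pderiv j (fun z => v z j) y
        + v y j * ((c y).rho * pderiv j (fun z => (q z).rho) y
            + (q y).rho * pderiv j (fun z => (c z).rho) y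
            + (∑ k, ((c y).mom k * pderiv j (fun z => (q z).mom k) y
              + (q y).mom k * pderiv j (fun z => (c z).mom k) y))
            + ((c y).ent * pderiv j (fun z => (q z).ent) y
              + (q y).ent * pderiv j (fun z => (c z).ent) y))
        - ∑ i, (stress q c i j y * pderiv j (fun z => v z i) y
            + v y i * pderiv j (stress q c i j) y) := by
    intro j
    unfold transportFlux
    rw [pderiv_sub ((((hcr.fun_mul hqr).fun_add hsum).fun_add (hce.fun_mul hqe)).fun_mul (hvj j))
        (DifferentiableAt.fun_sum fun i _ => (hS i j).fun_mul (hvj i)),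
      pderiv_mul (((hcr.fun_mul hqr).fun_add hsum).fun_add (hce.fun_mul hqe)) (hvj j),
      pderiv_add ((hcr.fun_mul hqr).fun_add hsum) (hce.fun_mul hqe),
      pderiv_add (hcr.fun_mul hqr) hsum, pderiv_mul hcr hqr, pderiv_mul hce hqe,
      pderiv_sum (fun k _ => (hcm k).fun_mul (hqm k)), pderiv_sum (fun i _ => (hS i j).fun_mul (hvj i))]
    simp only [pderiv_mul (hcm _) (hqm _), pderiv_mul (hS _ _) (hvj _)]
  -- What remains is a polynomial identity in the fields and their first derivatives; the
  -- derivatives of the stress occur on both sides and need no expansion.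
  simp only [hflux, EulerValue.pairing, ha.rho, ha.mom, ha.ent, ha.dfg, force]
  simp only [stress, Fin.sum_univ_three]
  ring

/-- The Eulerian bracket density is the Lagrangian one, up to a divergence. -/
lemma bracketDensity_eq (hΩ : IsOpen Ω) (hq : ContDiffOn ℝ ∞ q Ω)
    (hc : ContDiffOn ℝ ∞ c Ω) (hd : ContDiffOn ℝ ∞ d Ω) {y : Space3} (hy : y ∈ Ω) :
    fluidDensity q c d y + stretchDensity q c d y - advectDensity q c d y
      = (∑ i, (force q c y i * (d y).mom i - force q d y i * (c y).mom i))
        + ∑ j, pderiv j (bracketFlux q c d j) y := by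
  have D : ∀ {f : Space3 → ℝ}, ContDiffOn ℝ ∞ f Ω → DifferentiableAt ℝ f y := fun hf =>
    (hf.contDiffAt (hΩ.mem_nhds hy)).differentiableAt (by simp)
  have hcm := fun i => D (EulerValue.contDiffOn_mom hc i)
  have hdm := fun i => D (EulerValue.contDiffOn_mom hd i)
  have hSc := fun i j => D (contDiffOn_stress hq hc i j)
  have hSd := fun i j => D (contDiffOn_stress hq hd i j)
  have hflux : ∀ j, pderiv j (bracketFlux q c d j) y =
      ∑ i, ((stress q c i j y * pderiv j (fun z => (d z).mom i) y
          + (d y).mom i * pderiv j (stress q c i j) y)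
        - (stress q d i j y * pderiv j (fun z => (c z).mom i) y
          + (c y).mom i * pderiv j (stress q d i j) y)) := by
    intro j
    unfold bracketFlux
    rw [pderiv_sum (fun i _ => ((hSc i j).fun_mul (hdm i)).fun_sub ((hSd i j).fun_mul (hcm i)))]
    refine Finset.sum_congr rfl fun i _ => ?_
    rw [pderiv_sub ((hSc i j).fun_mul (hdm i)) ((hSd i j).fun_mul (hcm i)), pderiv_mul (hSc i j) (hdm i),
      pderiv_mul (hSd i j) (hcm i)]
  simp only [hflux, fluidDensity, stretchDensity, advectDensity, force]
  simp only [stress, Fin.sum_univ_three]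
  ring

end Densities

/-! ### Integration by parts over the region -/

section Brackets

variable {Ω K : Set Space3} {q c d : Space3 → EulerValue} {v P : Space3 → Space3}

/-- Since `Ω \ K` is open, vanishing there is vanishing near each point, so the boundary conditions
pass to derivatives. -/
lemma pderiv_eq_zero_of_vanish (hΩ : IsOpen Ω) (hK : IsClosed K) {f : Space3 → ℝ}
    (h0 : ∀ y ∈ Ω \ K, f y = 0) {y : Space3} (hy : y ∈ Ω \ K) (i : Fin 3) : pderiv i f y = 0 := by
  have h : f =ᶠ[nhds y] fun _ => (0 : ℝ) := by
    filter_upwards [(hΩ.sdiff hK).mem_nhds hy] with z hz using h0 z hz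
  rw [pderiv_congr h]
  simp [pderiv]

lemma EulerValue.rho_zero : (0 : EulerValue).rho = 0 := rfl
lemma EulerValue.mom_zero : (0 : EulerValue).mom = 0 := rfl
lemma EulerValue.ent_zero : (0 : EulerValue).ent = 0 := rfl
lemma EulerValue.dfg_zero (i I : Fin 3) : (0 : EulerValue).dfg i I = 0 := rfl

lemma stress_eq_zero {i j : Fin 3} {y : Space3} (h : c y = 0) : stress q c i j y = 0 := by
  simp [stress, h, EulerValue.dfg_zero]

lemma force_eq_zero_of_vanish (hΩ : IsOpen Ω) (hK : IsClosed K) (h0 : ∀ y ∈ Ω \ K, c y = 0)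
    {y : Space3} (hy : y ∈ Ω \ K) (i : Fin 3) : force q c y i = 0 := by
  have hr := pderiv_eq_zero_of_vanish hΩ hK (f := fun z => (c z).rho)
    (fun z hz => by simp [h0 z hz, EulerValue.rho_zero]) hy
  have hm := fun k => pderiv_eq_zero_of_vanish hΩ hK (f := fun z => (c z).mom k)
    (fun z hz => by simp [h0 z hz, EulerValue.mom_zero]) hy
  have he := pderiv_eq_zero_of_vanish hΩ hK (f := fun z => (c z).ent)
    (fun z hz => by simp [h0 z hz, EulerValue.ent_zero]) hy
  have hS := fun i j => pderiv_eq_zero_of_vanish hΩ hK (f := stress q c i j)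
    (fun z hz => stress_eq_zero (h0 z hz)) hy
  simp [force, hr, hm, he, hS, h0 y hy, EulerValue.dfg_zero]

/-- Integration by parts for the rate of change of a functional along transported fields. -/
lemma integral_pairing_of_isTransport (hΩ : IsOpen Ω) (hK : IsCompact K) (hKΩ : K ⊆ Ω)
    (hq : ContDiffOn ℝ ∞ q Ω) (hc : ContDiffOn ℝ ∞ c Ω) (hv : ContDiffOn ℝ ∞ v Ω)
    (hP : ContinuousOn P Ω)
    (h0 : (∀ y ∈ Ω \ K, c y = 0) ∨ ∀ y ∈ Ω \ K, v y = 0 ∧ P y = 0)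
    {a : Space3 → EulerValue} (ha : ∀ y ∈ Ω, IsTransport q v P y (a y)) :
    ∫ y in Ω, (c y).pairing (a y)
      = ∫ y in Ω, ((∑ i, force q c y i * v y i) + ∑ i, (c y).mom i * P y i) := by
  -- Each term of the flux is linear in `c` and in `v`, so either alternative kills it.
  have hflux : ∀ j, ∀ y ∈ Ω \ K, transportFlux q c v j y = 0 := by
    intro j y hy
    rcases h0 with h | h
    · simp [transportFlux, stress_eq_zero (h y hy), h y hy, EulerValue.rho_zero,
        EulerValue.mom_zero, EulerValue.ent_zero]
    · simp [transportFlux, (h y hy).1]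
  have hint : ∀ j, IntegrableOn (pderiv j (transportFlux q c v j)) Ω := fun j =>
    integrableOn_of_vanish hΩ.measurableSet hK hKΩ
      (contDiffOn_pderiv hΩ (contDiffOn_transportFlux hq hc hv j) j).continuousOn
      fun y hy => pderiv_eq_zero_of_vanish hΩ hK.isClosed (hflux j) hy j
  have hmain : IntegrableOn (fun y => (∑ i, force q c y i * v y i)
      + ∑ i, (c y).mom i * P y i) Ω := by
    refine integrableOn_of_vanish hΩ.measurableSet hK hKΩ ?_ ?_
    · refine (ContDiffOn.continuousOn (ContDiffOn.sum fun i _ =>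
        (contDiffOn_force hΩ hq hc i).mul (contDiffOn_coord hv i))).add
        (continuousOn_finsetSum _ fun i _ =>
          (EulerValue.contDiffOn_mom hc i).continuousOn.mul
            ((EuclideanSpace.proj (𝕜 := ℝ) i : Space3 →L[ℝ] ℝ).continuous.comp_continuousOn hP))
    · intro y hy
      rcases h0 with h | h
      · simp [force_eq_zero_of_vanish hΩ hK.isClosed h hy, h y hy, EulerValue.mom_zero]
      · simp [h y hy]
  rw [setIntegral_congr_fun hΩ.measurableSet fun y hy =>
    pairing_eq_of_isTransport hΩ hq hc hv hy (ha y hy),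
    integral_sub hmain (integrable_finsetSum _ fun j _ => hint j),
    integral_finsetSum _ fun j _ => hint j]
  simp only [integral_pderiv_eq_zero hΩ hK hKΩ (contDiffOn_transportFlux hq hc hv _) (hflux _)]
  simp

/-- The integrals of the Eulerian bracket converge, and the bracket is the integral of the
Lagrangian density in Eulerian coordinates. -/
lemma eulerianBracket_eq_integral_force (hΩ : IsOpen Ω) (hq : ContDiffOn ℝ ∞ q Ω)
    (hc : ContDiffOn ℝ ∞ c Ω) (hd : ContDiffOn ℝ ∞ d Ω) (h : VanishAtBoundary Ω c d) :
    EulerianBracketConverges Ω q c d ∧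
      IntegrableOn (fun y => ∑ i, (force q c y i * (d y).mom i - force q d y i * (c y).mom i)) Ω ∧
      eulerianBracket Ω q c d
        = ∫ y in Ω, ∑ i, (force q c y i * (d y).mom i - force q d y i * (c y).mom i) := by
  obtain ⟨K, hK, hKΩ, h0⟩ := h
  -- Every term has one factor from `c` and one from `d`, possibly differentiated, and at least one
  -- of the two comes from a momentum component. Each of the three boundary alternatives therefore
  -- suffices.
  have hzero : ∀ y ∈ Ω \ K, (fluidDensity q c d y = 0 ∧ stretchDensity q c d y = 0) ∧
      advectDensity q c d y = 0 ∧ (∀ j, bracketFlux q c d j y = 0) ∧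
      ∑ i, (force q c y i * (d y).mom i - force q d y i * (c y).mom i) = 0 := by
    intro y hy
    have comps : ∀ {a : Space3 → EulerValue}, (∀ z ∈ Ω \ K, a z = 0) →
        ((∀ i, pderiv i (fun z => (a z).rho) y = 0) ∧ (∀ i, pderiv i (fun z => (a z).ent) y = 0)) ∧
        (∀ i j, pderiv j (fun z => (a z).mom i) y = 0) := fun ha =>
      ⟨⟨fun i => pderiv_eq_zero_of_vanish hΩ hK.isClosed
          (fun z hz => by simp [ha z hz, EulerValue.rho_zero]) hy i,
        fun i => pderiv_eq_zero_of_vanish hΩ hK.isClosed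
          (fun z hz => by simp [ha z hz, EulerValue.ent_zero]) hy i⟩,
        fun i j => pderiv_eq_zero_of_vanish hΩ hK.isClosed
          (fun z hz => by simp [ha z hz, EulerValue.mom_zero]) hy j⟩
    rcases h0 with h | h | h
    · have hc0 := fun i j => pderiv_eq_zero_of_vanish hΩ hK.isClosed (f := fun z => (c z).mom i)
        (fun z hz => by simp [(h z hz).1]) hy j
      have hd0 := fun i j => pderiv_eq_zero_of_vanish hΩ hK.isClosed (f := fun z => (d z).mom i)
        (fun z hz => by simp [(h z hz).2]) hy j
      simp [fluidDensity, stretchDensity, advectDensity, bracketFlux, hc0, hd0, h y hy]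
    · obtain ⟨⟨h1, h2⟩, h3⟩ := comps h
      simp [fluidDensity, stretchDensity, advectDensity, bracketFlux, h y hy, h1, h2, h3,
        EulerValue.mom_zero, EulerValue.dfg_zero, stress_eq_zero (h y hy),
        force_eq_zero_of_vanish hΩ hK.isClosed h hy]
    · obtain ⟨⟨h1, h2⟩, h3⟩ := comps h
      simp [fluidDensity, stretchDensity, advectDensity, bracketFlux, h y hy, h1, h2, h3,
        EulerValue.mom_zero, EulerValue.dfg_zero, stress_eq_zero (h y hy),
        force_eq_zero_of_vanish hΩ hK.isClosed h hy]
  have I : ∀ {f : Space3 → ℝ}, ContDiffOn ℝ ∞ f Ω → (∀ y ∈ Ω \ K, f y = 0) → IntegrableOn f Ω :=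
    fun hf hf0 => integrableOn_of_vanish hΩ.measurableSet hK hKΩ hf.continuousOn hf0
  have hqr := EulerValue.contDiffOn_rho hq
  have hqm := EulerValue.contDiffOn_mom hq
  have hqe := EulerValue.contDiffOn_ent hq
  have hqF := EulerValue.contDiffOn_dfg hq
  have hcm := EulerValue.contDiffOn_mom hc
  have hcF := EulerValue.contDiffOn_dfg hc
  have hdm := EulerValue.contDiffOn_mom hd
  have hdF := EulerValue.contDiffOn_dfg hd
  have p : ∀ {f : Space3 → ℝ}, ContDiffOn ℝ ∞ f Ω → ∀ i, ContDiffOn ℝ ∞ (pderiv i f) Ω :=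
    fun hf i => contDiffOn_pderiv hΩ hf i
  have hfl : IntegrableOn (fluidDensity q c d) Ω := by
    refine I ?_ fun y hy => (hzero y hy).1.1
    refine ((ContDiffOn.sum fun i _ => hqr.mul (((p (EulerValue.contDiffOn_rho hc) i).mul
      (hdm i)).sub ((p (EulerValue.contDiffOn_rho hd) i).mul (hcm i)))).add
      (ContDiffOn.sum fun i _ => ContDiffOn.sum fun j _ => (hqm i).mul (((p (hcm i) j).mul
        (hdm j)).sub ((p (hdm i) j).mul (hcm j))))).add
      (ContDiffOn.sum fun i _ => hqe.mul (((p (EulerValue.contDiffOn_ent hc) i).mul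
        (hdm i)).sub ((p (EulerValue.contDiffOn_ent hd) i).mul (hcm i))))
  have hst : IntegrableOn (stretchDensity q c d) Ω := by
    refine I ?_ fun y hy => (hzero y hy).1.2
    exact ContDiffOn.sum fun i _ => ContDiffOn.sum fun j _ => ContDiffOn.sum fun I _ =>
      (hqF j I).mul (((hcF i I).mul (p (hdm i) j)).sub ((hdF i I).mul (p (hcm i) j)))
  have had : IntegrableOn (advectDensity q c d) Ω := by
    refine I ?_ fun y hy => (hzero y hy).2.1
    exact ContDiffOn.sum fun i _ => ContDiffOn.sum fun k _ => ContDiffOn.sum fun I _ =>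
      (p (hqF i I) k).mul (((hcF i I).mul (hdm k)).sub ((hdF i I).mul (hcm k)))
  have hL : IntegrableOn
      (fun y => ∑ i, (force q c y i * (d y).mom i - force q d y i * (c y).mom i)) Ω := by
    refine I ?_ fun y hy => (hzero y hy).2.2.2
    exact ContDiffOn.sum fun i _ => ((contDiffOn_force hΩ hq hc i).mul (hdm i)).sub
      ((contDiffOn_force hΩ hq hd i).mul (hcm i))
  have hflux : ∀ j, ∀ y ∈ Ω \ K, bracketFlux q c d j y = 0 := fun j y hy => (hzero y hy).2.2.1 j
  have hB : ∀ j, IntegrableOn (pderiv j (bracketFlux q c d j)) Ω := fun j =>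
    I (p (contDiffOn_bracketFlux hq hc hd j) j)
      fun y hy => pderiv_eq_zero_of_vanish hΩ hK.isClosed (hflux j) hy j
  refine ⟨⟨hfl, hst, had⟩, hL, ?_⟩
  rw [eulerianBracket, fluidBracket, ← integral_add hfl hst]
  have hsub := integral_sub (hfl.add hst) had
  simp only [Pi.add_apply] at hsub
  rw [← hsub]
  have hcongr := setIntegral_congr_fun (μ := volume) hΩ.measurableSet fun y hy =>
    bracketDensity_eq hΩ hq hc hd hy
  refine hcongr.trans ?_
  rw [integral_add hL (integrable_finsetSum _ fun j _ => hB j),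
    integral_finsetSum _ fun j _ => hB j]
  simp only [integral_pderiv_eq_zero hΩ hK hKΩ (contDiffOn_bracketFlux hq hc hd _) (hflux _)]
  simp

end Brackets

/-! ### The rate of change of a functional along a motion -/

/-- The Eulerian fields are smooth only on `Ω`; multiplying their change by such a cutoff makes it
an admissible variation on all of space. -/
lemma exists_cutoff {K Ω : Set Space3} (hK : IsCompact K) (hΩ : IsOpen Ω) (hKΩ : K ⊆ Ω) :
    ∃ χ : Space3 → ℝ, ContDiff ℝ ∞ χ ∧ HasCompactSupport χ ∧ tsupport χ ⊆ Ω ∧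
      ∀ y ∈ K, χ y = 1 := by
  obtain ⟨L, hL, hKL, hLΩ⟩ := exists_compact_between hK hΩ hKΩ
  obtain ⟨χ, h1, -, h3, h4⟩ := exists_contMDiff_support_eq_eq_one_iff
    (modelWithCornersSelf ℝ Space3) (n := ⊤) isOpen_interior hK.isClosed hKL
  have hs : tsupport χ ⊆ L := closure_minimal (h3 ▸ interior_subset) hL.isClosed
  exact ⟨χ, contMDiff_iff_contDiff.1 h1, hL.of_isClosed_subset (isClosed_tsupport χ) hs,
    hs.trans hLΩ, fun y hy => (h4 y).1 hy⟩

namespace IsSmoothMotion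

variable {Ω₀ Ω : Set Space3} {J : Set ℝ} {x M : ℝ → Space3 → Space3}

/-- The rate of change of a functional of the Eulerian fields along a smooth motion, if either the
functional only depends on the fields in a compact set or the fields only change there. -/
lemma hasDerivAt_functional (h : IsSmoothMotion Ω₀ Ω J x M) (hΩ₀ : IsOpen Ω₀) (hΩ : IsOpen Ω)
    (hJ : IsOpen J) {ρ₀ s₀ : Space3 → ℝ} (hρ₀ : ContDiffOn ℝ ∞ ρ₀ Ω₀)
    (hs₀ : ContDiffOn ℝ ∞ s₀ Ω₀) {t : ℝ} (ht : t ∈ J) {v P : Space3 → Space3}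
    (hvs : ContDiffOn ℝ ∞ v Ω) (hPs : ContinuousOn P Ω)
    (hv : ∀ Z ∈ Ω₀, HasDerivAt (fun s => x s Z) (v (x t Z)) t)
    (hP : ∀ Z ∈ Ω₀, HasDerivAt (fun s => M s Z) ((fderiv ℝ (x t) Z).det • P (x t Z)) t)
    {C : (Space3 → EulerValue) → ℝ} {c : Space3 → EulerValue}
    (hC : HasFrechetDeriv Ω C (eulerianFields Ω₀ Ω ρ₀ s₀ (x t) (M t)) c)
    {K : Set Space3} (hK : IsCompact K) (hKΩ : K ⊆ Ω)
    (h0 : (∀ y ∈ Ω \ K, c y = 0) ∨ ∀ y ∈ Ω \ K, v y = 0 ∧ P y = 0)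
    (hloc : ∀ χ : Space3 → ℝ, (∀ y ∈ K, χ y = 1) → ∀ τ ∈ J,
      C (eulerianFields Ω₀ Ω ρ₀ s₀ (x τ) (M τ))
        = C (eulerianFields Ω₀ Ω ρ₀ s₀ (x t) (M t) + fun y =>
          χ y • (eulerianFields Ω₀ Ω ρ₀ s₀ (x τ) (M τ) y
            - eulerianFields Ω₀ Ω ρ₀ s₀ (x t) (M t) y))) :
    HasDerivAt (fun τ => C (eulerianFields Ω₀ Ω ρ₀ s₀ (x τ) (M τ)))
      (∫ y in Ω, ((∑ i, force (eulerianFields Ω₀ Ω ρ₀ s₀ (x t) (M t)) c y i * v y i)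
        + ∑ i, (c y).mom i * P y i)) t := by
  obtain ⟨χ, hχ, hχc, hχΩ, hχ1⟩ := exists_cutoff hK hΩ hKΩ
  set Q : ℝ × Space3 → EulerValue :=
    fun p => eulerianFields Ω₀ Ω ρ₀ s₀ (x p.1) (M p.1) p.2 with hQdef
  have hQ : ContDiffOn ℝ ∞ Q (J ×ˢ Ω) := h.contDiffOn_eulerianFields hΩ₀ hΩ hJ hρ₀ hs₀
  have hqt : ContDiffOn ℝ ∞ (fun y => Q (t, y)) Ω :=
    hQ.comp (contDiff_prodMk_right t).contDiffOn fun y hy => ⟨ht, hy⟩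
  -- The cut-off change of the fields is zero at time `t` and supported in the fixed compact set
  -- `tsupport χ`; by `hloc` the functional does not notice the cutoff.
  set H : ℝ × Space3 → EulerValue := fun p => χ p.2 • (Q p - Q (t, p.2)) with hHdef
  have hH : ContDiffOn ℝ ∞ H (J ×ˢ univ) := by
    rintro ⟨τ, y⟩ ⟨hτ, -⟩
    by_cases hy : y ∈ Ω
    · have hJΩ := (hJ.prod hΩ).mem_nhds (show (τ, y) ∈ J ×ˢ Ω from ⟨hτ, hy⟩)
      refine ContDiffAt.contDiffWithinAt ?_
      exact (hχ.contDiffAt.comp (τ, y) contDiff_snd.contDiffAt).smul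
        ((hQ.contDiffAt hJΩ).sub
          ((hqt.comp contDiff_snd.contDiffOn fun p (hp : p ∈ J ×ˢ Ω) => hp.2).contDiffAt hJΩ))
    · refine ((contDiffAt_const (c := (0 : EulerValue))).congr_of_eventuallyEq
        ?_).contDiffWithinAt
      have hy' : y ∈ (tsupport χ)ᶜ := fun hy' => hy (hχΩ hy')
      filter_upwards [(isClosed_tsupport χ).isOpen_compl.preimage continuous_snd |>.mem_nhds
        (show (τ, y) ∈ Prod.snd ⁻¹' (tsupport χ)ᶜ from hy')] with p hp
      simp [hHdef, image_eq_zero_of_notMem_tsupport hp]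
  have key := hC.hasDerivAt_curve hΩ hJ ht hχc hχΩ hH
    (fun τ _ y hy => by simp [hHdef, image_eq_zero_of_notMem_tsupport hy])
    (fun y => by simp [hHdef])
  have hev : (fun τ => C (eulerianFields Ω₀ Ω ρ₀ s₀ (x τ) (M τ))) =ᶠ[nhds t]
      fun τ => C (eulerianFields Ω₀ Ω ρ₀ s₀ (x t) (M t) + fun y => H (τ, y)) := by
    filter_upwards [hJ.mem_nhds ht] with τ hτ using hloc χ hχ1 τ hτ
  refine (key.congr_of_eventuallyEq hev).congr_deriv ?_
  have hT : ∀ y ∈ Ω, IsTransport (eulerianFields Ω₀ Ω ρ₀ s₀ (x t) (M t)) v P y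
      (fderiv ℝ Q (t, y) (1, 0)) := fun y hy =>
    h.isTransport hΩ₀ hΩ hJ hρ₀ hs₀ ht hvs hv hP hy
  rw [← integral_pairing_of_isTransport hΩ hK hKΩ hqt hC.smooth hvs hPs h0 hT]
  refine setIntegral_congr_fun hΩ.measurableSet fun y hy => ?_
  have hHy : fderiv ℝ H (t, y) (1, 0) = χ y • fderiv ℝ Q (t, y) (1, 0) := by
    have hl : HasDerivAt (fun s : ℝ => ((s, y) : ℝ × Space3)) (1, 0) t :=
      (hasDerivAt_id t).prodMk (hasDerivAt_const t y)
    have h1 : HasDerivAt (fun s => H (s, y)) (fderiv ℝ H (t, y) (1, 0)) t :=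
      ((hH.contDiffAt ((hJ.prod isOpen_univ).mem_nhds ⟨ht, mem_univ _⟩)).differentiableAt
        (by simp)).hasFDerivAt.comp_hasDerivAt_of_eq t hl rfl
    have h2 : HasDerivAt (fun s => Q (s, y)) (fderiv ℝ Q (t, y) (1, 0)) t :=
      ((hQ.contDiffAt ((hJ.prod hΩ).mem_nhds ⟨ht, hy⟩)).differentiableAt
        (by simp)).hasFDerivAt.comp_hasDerivAt_of_eq t hl rfl
    exact h1.unique ((h2.sub_const (Q (t, y))).const_smul (χ y))
  simp only [hHy, EulerValue.pairing_smul_right]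
  -- The cutoff drops out of the derivative: it is 1 on `K`, and off `K` either `c` vanishes or the
  -- transport equations with v = P = 0 give a zero rate.
  by_cases hyK : y ∈ K
  · rw [hχ1 y hyK, one_mul]
  · suffices (c y).pairing (fderiv ℝ Q (t, y) (1, 0)) = 0 by rw [this, mul_zero]
    rcases h0 with h0 | h0
    · rw [h0 y ⟨hy, hyK⟩, EulerValue.pairing_zero_left]
    · have hz := hT y hy
      have hd : ∀ i j, pderiv j (fun z => v z i) y = 0 := fun i j =>
        pderiv_eq_zero_of_vanish hΩ hK.isClosed (fun z hz => by simp [(h0 z hz).1]) ⟨hy, hyK⟩ j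
      simp [EulerValue.pairing, hz.rho, hz.mom, hz.ent, hz.dfg, hd, h0 y ⟨hy, hyK⟩]

end IsSmoothMotion

/-! ### Stability of placements under compactly supported variations -/

/-- A small perturbation with compact support of a placement is a placement. -/
lemma IsPlacement.exists_perturbation {Ω₀ Ω : Set Space3} (hΩ₀ : IsOpen Ω₀) (hΩ : IsOpen Ω)
    {x : Space3 → Space3} (hx : IsPlacement Ω₀ Ω x) {h : Space3 → Space3}
    (hh : IsVariation Ω₀ h) :
    ∃ δ : ℝ, 0 < δ ∧ ∀ l : ℝ, |l| < δ → IsPlacement Ω₀ Ω (x + l • h) := by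
  set K := x '' tsupport h with hKdef
  have hK : IsCompact K := hh.compact.isCompact.image_of_continuousOn
    (hx.smooth.continuousOn.mono hh.subset)
  have hKΩ : K ⊆ Ω := by
    rintro _ ⟨Z, hZ, rfl⟩
    exact hx.bijOn.mapsTo (hh.subset hZ)
  -- The displacement is carried over to `Ω`, so that on the body x + l h = (id + l η)∘x.
  -- Bijectivity then concerns only a Lipschitz perturbation of the identity of the whole space.
  set η : Space3 → Space3 := Ω.indicator fun y => h (Function.invFunOn x Ω₀ y) with hη
  have hη0 : ∀ y ∈ Ω \ K, h (Function.invFunOn x Ω₀ y) = 0 := by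
    intro y hy
    refine image_eq_zero_of_notMem_tsupport fun hy' => hy.2 ⟨_, hy', hx.apply_invFunOn hy.1⟩
  have hηs : ContDiff ℝ 1 η := contDiff_indicator_of_compact hΩ hK.isClosed hKΩ
    ((hh.smooth.comp_contDiffOn (hx.contDiffOn_invFunOn hΩ₀)).of_le (by simp)) hη0
  obtain ⟨L, hL⟩ := hηs.lipschitzWith_of_hasCompactSupport (hasCompactSupport_indicator hK hη0)
    (by simp)
  have hηx : ∀ Z ∈ Ω₀, η (x Z) = h Z := fun Z hZ => by
    simp [hη, hx.bijOn.mapsTo hZ, hx.invFunOn_apply hZ]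
  have hηout : ∀ y ∉ Ω, η y = 0 := fun y hy => by simp [hη, hy]
  -- Off the support the Jacobian is unchanged; on the compact support positivity at l = 0 persists
  -- uniformly for small l.
  have hdet : ∀ᶠ l : ℝ in nhds 0, ∀ Z ∈ tsupport h, 0 < (fderiv ℝ x Z + l • fderiv ℝ h Z).det := by
    refine hh.compact.isCompact.eventually_forall_of_forall_eventually fun Z hZ => ?_
    have hZ0 := hh.subset hZ
    have h1 : ContinuousAt (fun p : ℝ × Space3 => fderiv ℝ x p.2 + p.1 • fderiv ℝ h p.2) (0, Z) := by
      have ha : ContinuousAt (fderiv ℝ x) Z :=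
        (hx.smooth.continuousOn_fderiv_of_isOpen hΩ₀ (by simp)).continuousAt (hΩ₀.mem_nhds hZ0)
      have hb : Continuous (fderiv ℝ h) := hh.smooth.continuous_fderiv (by simp)
      exact (ha.comp_of_eq continuousAt_snd rfl).add
        (continuousAt_fst.smul (hb.continuousAt.comp continuousAt_snd))
    have h2 := Space3.contDiff_det.continuous.continuousAt.comp h1
    refine h2.eventually (lt_mem_nhds ?_)
    change 0 < (fderiv ℝ x Z + (0 : ℝ) • fderiv ℝ h Z).det
    rw [zero_smul ℝ (fderiv ℝ h Z), add_zero]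
    exact hx.det_pos Z hZ0
  obtain ⟨δ, hδ, hδdet⟩ := Metric.eventually_nhds_iff.1 hdet
  -- The second bound gives |l| L < 1, so that id + l η is a bijection of space; adding 1 covers L =
  -- 0.
  refine ⟨min δ ((L : ℝ) + 1)⁻¹, by positivity, fun l hl => ?_⟩
  have hl1 : |l| < δ := hl.trans_le (min_le_left _ _)
  have hl2 : |l| * L < 1 := by
    have h1 : |l| < ((L : ℝ) + 1)⁻¹ := hl.trans_le (min_le_right _ _)
    have h2 : |l| * ((L : ℝ) + 1) < 1 := by
      rwa [← lt_div_iff₀ (by positivity), one_div]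
    nlinarith [abs_nonneg l]
  set φ : Space3 → Space3 := fun y => y + l • η y with hφ
  have happ : ApproximatesLinearOn φ
      ((ContinuousLinearEquiv.refl ℝ Space3 : Space3 ≃L[ℝ] Space3) : Space3 →L[ℝ] Space3) univ
      (‖l‖₊ * L) := by
    rw [ApproximatesLinearOn.approximatesLinearOn_iff_lipschitzOnWith]
    refine LipschitzWith.lipschitzOnWith ?_
    have : (φ - ((ContinuousLinearEquiv.refl ℝ Space3 : Space3 ≃L[ℝ] Space3) :
        Space3 →L[ℝ] Space3)) = fun y => l • η y := by
      ext1 y; simp [hφ]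
    rw [this]
    exact (lipschitzWith_smul l).comp hL
  have hc : Subsingleton Space3 ∨ ‖l‖₊ * L <
      ‖((ContinuousLinearEquiv.refl ℝ Space3).symm : Space3 →L[ℝ] Space3)‖₊⁻¹ := by
    right
    have h1 : ‖((ContinuousLinearEquiv.refl ℝ Space3).symm : Space3 →L[ℝ] Space3)‖₊ = 1 := by
      apply NNReal.eq
      simp
    rw [h1, inv_one, ← NNReal.coe_lt_coe]
    simpa using hl2
  have hφi : Function.Injective φ := by
    intro a b hab
    have := happ.injective hc (a₁ := ⟨a, mem_univ _⟩) (a₂ := ⟨b, mem_univ _⟩) hab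
    simpa using this
  have hφs : Function.Surjective φ := happ.surjective hc
  have hφout : ∀ y ∉ Ω, φ y = y := fun y hy => by simp [hφ, hηout y hy]
  -- A bijection of space that fixes every point outside `Ω` must map `Ω` onto itself.
  have hφΩ : BijOn φ Ω Ω := by
    refine ⟨fun y hy => ?_, hφi.injOn, fun z hz => ?_⟩
    · by_contra hn
      exact hn (by rw [hφi (hφout _ hn)]; exact hy)
    · obtain ⟨y, rfl⟩ := hφs z
      refine ⟨y, ?_, rfl⟩
      by_contra hn
      rw [hφout y hn] at hz
      exact hn hz
  refine ⟨hx.smooth.add (contDiff_const.smul hh.smooth).contDiffOn, ?_, fun Z hZ => ?_⟩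
  · refine (hφΩ.comp hx.bijOn).congr fun Z hZ => ?_
    simp [hφ, hηx Z hZ]
  · have hfd : fderiv ℝ (x + l • h) Z = fderiv ℝ x Z + l • fderiv ℝ h Z := by
      have hhd : DifferentiableAt ℝ h Z := hh.smooth.differentiable (by simp) Z
      exact ((hx.differentiableAt hΩ₀ hZ).hasFDerivAt.add (hhd.hasFDerivAt.const_smul l)).fderiv
    rw [hfd]
    by_cases hZs : Z ∈ tsupport h
    · exact hδdet (by simpa using hl1) Z hZs
    · have : fderiv ℝ h Z = 0 := by
        have he : h =ᶠ[nhds Z] fun _ => 0 := notMem_tsupport_iff_eventuallyEq.1 hZs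
        rw [he.fderiv_eq]; simp
      rw [this, smul_zero (A := Space3 →L[ℝ] Space3) l, add_zero]
      exact hx.det_pos Z hZ

/-! ### Uniqueness of functional derivatives and localization -/

/-- The fundamental lemma of the calculus of variations for continuous functions. -/
lemma eqOn_zero_of_forall_integral_eq_zero {U : Set Space3} (hU : IsOpen U) {f : Space3 → ℝ}
    (hf : ContinuousOn f U)
    (h : ∀ φ : Space3 → ℝ, IsVariation U φ → ∫ y, φ y * f y = 0) : EqOn f 0 U := by
  have hae := hU.ae_eq_zero_of_integral_contDiff_smul_eq_zero (μ := volume)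
    (hf.locallyIntegrableOn hU.measurableSet) fun φ h1 h2 h3 => h φ ⟨h1, h2, h3⟩
  exact Measure.eqOn_open_of_ae_eq ((ae_restrict_iff' hU.measurableSet).2 hae) hU hf
    continuousOn_const

/-- Continuous functional derivatives are unique. -/
lemma HasFunctionalDeriv.eqOn {Ω : Set Space3} (hΩ : IsOpen Ω)
    {Φ : (Space3 → Space3) → ℝ} {f g₁ g₂ : Space3 → Space3} (h₁ : HasFunctionalDeriv Ω Φ f g₁)
    (h₂ : HasFunctionalDeriv Ω Φ f g₂) (hg₁ : ContinuousOn g₁ Ω) (hg₂ : ContinuousOn g₂ Ω) :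
    EqOn g₁ g₂ Ω := by
  have hcoord : ∀ {g : Space3 → Space3}, ContinuousOn g Ω → ∀ i, ContinuousOn (fun y => g y i) Ω :=
    fun hg i => (EuclideanSpace.proj (𝕜 := ℝ) i : Space3 →L[ℝ] ℝ).continuous.comp_continuousOn hg
  have key : ∀ i, EqOn (fun y => g₁ y i - g₂ y i) 0 Ω := by
    intro i
    refine eqOn_zero_of_forall_integral_eq_zero hΩ ((hcoord hg₁ i).sub (hcoord hg₂ i)) ?_
    intro φ hφ
    have hvar : IsVariation Ω (fun y => φ y • (EuclideanSpace.single i 1 : Space3)) := by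
      have hs : tsupport (fun y => φ y • (EuclideanSpace.single i 1 : Space3)) ⊆ tsupport φ :=
        closure_mono fun y hy hy' => hy (by simp [hy'])
      exact ⟨hφ.smooth.smul contDiff_const,
        hφ.compact.of_isClosed_subset (isClosed_tsupport _) hs, hs.trans hφ.subset⟩
    have h := (h₁ _ hvar).unique (h₂ _ hvar)
    have hsum : ∀ g : Space3 → Space3, ∀ y,
        ∑ j, g y j * (φ y • (EuclideanSpace.single i 1 : Space3)) j = φ y * g y i := by
      intro g y
      simp [mul_comm]
    simp only [hsum] at h
    have hint : ∀ {g : Space3 → Space3}, ContinuousOn g Ω →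
        IntegrableOn (fun y => φ y * g y i) Ω := fun hg =>
      integrableOn_of_vanish hΩ.measurableSet hφ.compact hφ.subset
        (hφ.smooth.continuous.continuousOn.mul (hcoord hg i))
        fun y hy => by simp [image_eq_zero_of_notMem_tsupport hy.2]
    rw [← setIntegral_eq_integral_of_forall_compl_eq_zero (s := Ω)]
    · simp only [mul_sub]
      rw [integral_sub (hint hg₁) (hint hg₂), h, sub_self]
    · intro y hy
      simp [image_eq_zero_of_notMem_tsupport fun hy' => hy (hφ.subset hy')]
  intro y hy
  ext i
  exact sub_eq_zero.1 (key i hy)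

/-- The pairing of a value with itself is a sum of squares of all its components. -/
lemma EulerValue.eq_zero_of_pairing_self {a : EulerValue} (h : a.pairing a = 0) : a = 0 := by
  have h2 : 0 ≤ ∑ i, a.mom i * a.mom i := Finset.sum_nonneg fun i _ => mul_self_nonneg _
  have h4 : 0 ≤ ∑ i, ∑ I, a.dfg i I * a.dfg i I :=
    Finset.sum_nonneg fun i _ => Finset.sum_nonneg fun I _ => mul_self_nonneg _
  have h1 := mul_self_nonneg a.rho
  have h3 := mul_self_nonneg a.ent
  unfold EulerValue.pairing at h
  have e1 : a.rho = 0 := mul_self_eq_zero.1 (by linarith)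
  have e3 : a.ent = 0 := mul_self_eq_zero.1 (by linarith)
  have e2 : ∑ i, a.mom i * a.mom i = 0 := by linarith
  have e4 : ∑ i, ∑ I, a.dfg i I * a.dfg i I = 0 := by linarith
  rw [Finset.sum_eq_zero_iff_of_nonneg fun i _ => mul_self_nonneg _] at e2
  rw [Finset.sum_eq_zero_iff_of_nonneg fun i _ =>
    Finset.sum_nonneg fun I _ => mul_self_nonneg _] at e4
  have e2' : a.mom = 0 := by
    ext i
    exact mul_self_eq_zero.1 (e2 i (Finset.mem_univ i))
  have e4' : a.dfg = 0 := by
    ext i I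
    have := e4 i (Finset.mem_univ i)
    rw [Finset.sum_eq_zero_iff_of_nonneg fun I _ => mul_self_nonneg _] at this
    exact mul_self_eq_zero.1 (this I (Finset.mem_univ I))
  exact Prod.ext e1 (Prod.ext e2' (Prod.ext e3 e4'))

/-- The functional derivative of a localized functional has compact support. -/
lemma HasFrechetDeriv.eq_zero_of_localized {Ω K : Set Space3} (hΩ : IsOpen Ω)
    (hK : IsCompact K) {C : (Space3 → EulerValue) → ℝ}
    (hloc : ∀ q q' : Space3 → EulerValue, (∀ y ∈ K, q y = q' y) → C q = C q')
    {q c : Space3 → EulerValue} (hC : HasFrechetDeriv Ω C q c) : ∀ y ∈ Ω \ K, c y = 0 := by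
  have hU : IsOpen (Ω \ K) := hΩ.sdiff hK.isClosed
  -- Variations φ e supported off `K` leave `C` constant, so the integral of φ (c · e) vanishes for
  -- every test function φ.
  have key : ∀ e : EulerValue, EqOn (fun y => (c y).pairing e) 0 (Ω \ K) := by
    intro e
    refine eqOn_zero_of_forall_integral_eq_zero hU
      ((EulerValue.contDiffOn_pairing hC.smooth contDiffOn_const).continuousOn.mono
        sdiff_subset) ?_
    intro φ hφ
    have hd := hC.hasDerivAt_curve hΩ (J := univ) isOpen_univ (t := 0) (mem_univ _)
      (K := tsupport φ) hφ.compact (hφ.subset.trans sdiff_subset)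
      (H := fun p => p.1 • φ p.2 • e)
      ((contDiff_fst.smul ((hφ.smooth.comp contDiff_snd).smul contDiff_const)).contDiffOn)
      (fun τ _ y hy => by simp [image_eq_zero_of_notMem_tsupport hy]) (fun y => by simp)
    have hconst : (fun τ : ℝ => C (q + fun y => τ • φ y • e)) = fun _ => C q := by
      ext1 τ
      refine hloc _ _ fun y hy => ?_
      have : φ y = 0 := image_eq_zero_of_notMem_tsupport fun hy' => (hφ.subset hy').2 hy
      simp [this]
    rw [hconst] at hd
    have hz := (hasDerivAt_const (0 : ℝ) (C q)).unique hd
    have hfd : ∀ y, fderiv ℝ (fun p : ℝ × Space3 => p.1 • φ p.2 • e) (0, y) (1, 0) = φ y • e := by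
      intro y
      have hs : ContDiff ℝ ∞ (fun p : ℝ × Space3 => p.1 • φ p.2 • e) :=
        contDiff_fst.smul ((hφ.smooth.comp contDiff_snd).smul contDiff_const)
      have h1 : HasDerivAt (fun s : ℝ => s • φ y • e)
          (fderiv ℝ (fun p : ℝ × Space3 => p.1 • φ p.2 • e) (0, y) (1, 0)) 0 :=
        (hs.differentiable (by simp) (0, y)).hasFDerivAt.comp_hasDerivAt_of_eq 0
          ((hasDerivAt_id (0 : ℝ)).prodMk (hasDerivAt_const (0 : ℝ) y)) rfl
      have h2 := (hasDerivAt_id (0 : ℝ)).smul_const (φ y • e)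
      rw [one_smul] at h2
      exact h1.unique h2
    simp only [hfd, EulerValue.pairing_smul_right] at hz
    rw [setIntegral_eq_integral_of_forall_compl_eq_zero] at hz
    · exact hz.symm
    · intro y hy
      simp [image_eq_zero_of_notMem_tsupport fun hy' => hy (hφ.subset hy').1]
  intro y hy
  -- The constant direction `e` is chosen to be the value of `c` at this one point.
  exact EulerValue.eq_zero_of_pairing_self (key (c y) hy)

/-! ### Functional derivatives of the induced Lagrangian functionals -/

noncomputable section

/-- The functional derivative with respect to the placement of a functional of the Eulerian fields
with functional derivative `c` at `q`. -/
def placementDeriv (q c : Space3 → EulerValue) (x : Space3 → Space3) (Z : Space3) : Space3 :=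
  WithLp.toLp 2 fun i => (fderiv ℝ x Z).det * force q c (x Z) i

/-- The functional derivative with respect to the momentum of a functional of the Eulerian fields
with functional derivative `c`. -/
def momentumDeriv (c : Space3 → EulerValue) (x : Space3 → Space3) (Z : Space3) : Space3 :=
  (c (x Z)).mom

end

namespace IsPlacement

variable {Ω₀ Ω : Set Space3} {ρ₀ s₀ : Space3 → ℝ} {x M : Space3 → Space3}

/-- A single state regarded as a motion at rest inherits the regularity results for motions. -/
lemma isSmoothMotion_const (hx : IsPlacement Ω₀ Ω x) (hM : ContDiffOn ℝ ∞ M Ω₀) :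
    IsSmoothMotion Ω₀ Ω univ (fun _ => x) (fun _ => M) :=
  ⟨fun _ _ => hx, hx.smooth.comp contDiff_snd.contDiffOn fun _ hp => hp.2,
    hM.comp contDiff_snd.contDiffOn fun _ hp => hp.2⟩

lemma contDiffOn_eulerianFields (hx : IsPlacement Ω₀ Ω x) (hΩ₀ : IsOpen Ω₀) (hΩ : IsOpen Ω)
    (hρ₀ : ContDiffOn ℝ ∞ ρ₀ Ω₀) (hs₀ : ContDiffOn ℝ ∞ s₀ Ω₀) (hM : ContDiffOn ℝ ∞ M Ω₀) :
    ContDiffOn ℝ ∞ (eulerianFields Ω₀ Ω ρ₀ s₀ x M) Ω :=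
  ((hx.isSmoothMotion_const hM).contDiffOn_eulerianFields hΩ₀ hΩ isOpen_univ hρ₀ hs₀).comp
    (contDiff_prodMk_right 0).contDiffOn fun _ hy => ⟨mem_univ _, hy⟩

/-- Two Lagrangian states that agree off the support of a variation have the same Eulerian fields
off the image of that support. -/
lemma eulerianFields_eq_of_eqOn (hx : IsPlacement Ω₀ Ω x) (hΩ₀ : IsOpen Ω₀)
    {x' M' : Space3 → Space3} (hx' : IsPlacement Ω₀ Ω x') {S : Set Space3} (hS : IsClosed S)
    (hxx : EqOn x' x Sᶜ) (hMM : EqOn M' M Sᶜ) {y : Space3} (hy : y ∉ x '' S) :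
    eulerianFields Ω₀ Ω ρ₀ s₀ x' M' y = eulerianFields Ω₀ Ω ρ₀ s₀ x M y := by
  by_cases hyΩ : y ∈ Ω
  · obtain ⟨Z, hZ, rfl⟩ : ∃ Z ∈ Ω₀, x Z = y := ⟨_, hx.invFunOn_mem hyΩ, hx.apply_invFunOn hyΩ⟩
    have hZS : Z ∈ Sᶜ := fun h => hy ⟨Z, h, rfl⟩
    have hfd : fderiv ℝ x' Z = fderiv ℝ x Z :=
      (hxx.eventuallyEq_of_mem (hS.isOpen_compl.mem_nhds hZS)).fderiv_eq
    have h1 := hx'.eulerianFields_apply hΩ₀ ρ₀ s₀ M' hZ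
    rw [hxx hZS, hfd, hMM hZS] at h1
    rw [h1, hx.eulerianFields_apply hΩ₀ ρ₀ s₀ M hZ]
  · simp [eulerianFields, hyΩ]

/-- The functional derivatives of the Lagrangian functional induced by a differentiable functional
of the Eulerian fields. -/
lemma hasLagrangianDeriv_pullback (hx : IsPlacement Ω₀ Ω x) (hΩ₀ : IsOpen Ω₀) (hΩ : IsOpen Ω)
    (hρ₀ : ContDiffOn ℝ ∞ ρ₀ Ω₀) (hs₀ : ContDiffOn ℝ ∞ s₀ Ω₀) (hM : ContDiffOn ℝ ∞ M Ω₀)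
    {C : (Space3 → EulerValue) → ℝ} {c : Space3 → EulerValue}
    (hC : HasFrechetDeriv Ω C (eulerianFields Ω₀ Ω ρ₀ s₀ x M) c) :
    HasLagrangianDeriv Ω₀ (pullback Ω₀ Ω ρ₀ s₀ C) x M
      (placementDeriv (eulerianFields Ω₀ Ω ρ₀ s₀ x M) c x) (momentumDeriv c x) := by
  set q := eulerianFields Ω₀ Ω ρ₀ s₀ x M with hqdef
  have hq : ContDiffOn ℝ ∞ q Ω := hx.contDiffOn_eulerianFields hΩ₀ hΩ hρ₀ hs₀ hM
  have hX := hx.contDiffOn_invFunOn hΩ₀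
  have himg : ∀ {S : Set Space3}, IsCompact S → S ⊆ Ω₀ → IsCompact (x '' S) ∧ x '' S ⊆ Ω :=
    fun hS hS0 => ⟨hS.image_of_continuousOn (hx.smooth.continuousOn.mono hS0),
      (image_mono hS0).trans hx.bijOn.mapsTo.image_subset⟩
  have hoff : ∀ {h : Space3 → Space3}, ∀ y ∈ Ω \ x '' tsupport h,
      h (Function.invFunOn x Ω₀ y) = 0 := fun y hy =>
    image_eq_zero_of_notMem_tsupport fun hy' => hy.2 ⟨_, hy', hx.apply_invFunOn hy.1⟩
  -- The fields change only on the image of `S`, where χ = 1. Elsewhere the difference is zero, also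
  -- outside `Ω`, because both fields are set to zero there.
  have hloc : ∀ {S : Set Space3} {x' M' : Space3 → Space3}, IsClosed S → IsPlacement Ω₀ Ω x' →
      EqOn x' x Sᶜ → EqOn M' M Sᶜ → ∀ χ : Space3 → ℝ, (∀ y ∈ x '' S, χ y = 1) →
      C (eulerianFields Ω₀ Ω ρ₀ s₀ x' M') = C (q + fun y =>
        χ y • (eulerianFields Ω₀ Ω ρ₀ s₀ x' M' y - q y)) := by
    intro S x' M' hS hx' hxx hMM χ hχ
    congr 1
    ext1 y
    by_cases hy : y ∈ x '' S
    · simp [hχ y hy]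
    · simp [hx.eulerianFields_eq_of_eqOn hΩ₀ hx' hS hxx hMM hy, hqdef]
  have hdet : ContinuousOn (fun Z => (fderiv ℝ x Z).det) Ω₀ :=
    Space3.contDiff_det.continuous.comp_continuousOn
      (hx.smooth.continuousOn_fderiv_of_isOpen hΩ₀ (by simp))
  refine ⟨?_, ?_, fun h hh => ?_, fun h hh => ?_⟩
  · refine (PiLp.continuous_toLp 2 _).comp_continuousOn (continuousOn_pi.2 fun i => ?_)
    exact hdet.mul ((contDiffOn_force hΩ hq hC.smooth i).continuousOn.comp hx.smooth.continuousOn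
      hx.bijOn.mapsTo)
  · have hmom : ContDiffOn ℝ ∞ (fun y => (c y).mom) Ω := hC.smooth.snd.fst
    exact hmom.continuousOn.comp hx.smooth.continuousOn hx.bijOn.mapsTo
  · obtain ⟨δ, hδ, hpl⟩ := hx.exists_perturbation hΩ₀ hΩ hh
    have hx0 : x + (0 : ℝ) • h = x := by simp
    have hmotion : IsSmoothMotion Ω₀ Ω (Metric.ball 0 δ) (fun l => x + l • h) (fun _ => M) := by
      refine ⟨fun l hl => hpl l (by simpa using hl), ?_,
        hM.comp contDiff_snd.contDiffOn fun _ hp => hp.2⟩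
      exact (hx.smooth.comp contDiff_snd.contDiffOn fun _ hp => hp.2).add
        (contDiff_fst.smul (hh.smooth.comp contDiff_snd)).contDiffOn
    obtain ⟨hK, hKΩ⟩ := himg hh.compact hh.subset
    -- A straight line of placements with `M` held fixed has velocity h(X) and P = 0.
    have key := hmotion.hasDerivAt_functional hΩ₀ hΩ Metric.isOpen_ball hρ₀ hs₀
      (Metric.mem_ball_self hδ) (v := fun y => h (Function.invFunOn x Ω₀ y)) (P := fun _ => 0)
      (hh.smooth.comp_contDiffOn hX) continuousOn_const
      (fun Z hZ => by
        simp only [hx0, hx.invFunOn_apply hZ]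
        have := ((hasDerivAt_id (0 : ℝ)).smul_const (h Z)).const_add (x Z)
        simpa using this)
      (fun Z hZ => by
        rw [smul_zero]
        exact hasDerivAt_const _ _)
      (C := C) (c := c) (by simpa only [hx0] using hC) hK hKΩ
      (Or.inr fun y hy => ⟨hoff y hy, rfl⟩)
      (fun χ hχ l hl => by
        simp only [hx0]
        refine hloc (isClosed_tsupport h) (hpl l (by simpa using hl)) (fun Z hZ => ?_)
          (fun _ _ => rfl) χ hχ
        simp [image_eq_zero_of_notMem_tsupport hZ])
    simp only [hx0] at key
    refine key.congr_deriv ?_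
    rw [hx.setIntegral_eq hΩ₀]
    refine setIntegral_congr_fun hΩ₀.measurableSet fun Z hZ => ?_
    simp only [hx.invFunOn_apply hZ, placementDeriv, PiLp.zero_apply, mul_zero,
      Finset.sum_const_zero, add_zero, Finset.mul_sum, mul_assoc, hqdef]
  · have hM0 : M + (0 : ℝ) • h = M := by simp
    have hmotion : IsSmoothMotion Ω₀ Ω univ (fun _ => x) (fun l => M + l • h) := by
      refine ⟨fun _ _ => hx, hx.smooth.comp contDiff_snd.contDiffOn fun _ hp => hp.2, ?_⟩
      exact (hM.comp contDiff_snd.contDiffOn fun _ hp => hp.2).add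
        (contDiff_fst.smul (hh.smooth.comp contDiff_snd)).contDiffOn
    obtain ⟨hK, hKΩ⟩ := himg hh.compact hh.subset
    have hP : ContinuousOn (fun y => ((fderiv ℝ x (Function.invFunOn x Ω₀ y)).det)⁻¹ •
        h (Function.invFunOn x Ω₀ y)) Ω := by
      have hm : MapsTo (Function.invFunOn x Ω₀) Ω Ω₀ := fun y hy => hx.invFunOn_mem hy
      exact ((hdet.comp hX.continuousOn hm).inv₀ fun y hy => (hx.det_pos _ (hm hy)).ne').smul
        (hh.smooth.continuous.comp_continuousOn hX.continuousOn)
    -- With the placement at rest, the rate h of `M` corresponds to P = h(X)/det; the Jacobian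
    -- cancels in the change of variables below.
    have key := hmotion.hasDerivAt_functional hΩ₀ hΩ isOpen_univ hρ₀ hs₀
      (mem_univ (0 : ℝ)) (v := fun _ => 0) contDiffOn_const hP
      (fun Z hZ => hasDerivAt_const _ _)
      (fun Z hZ => by
        simp only [hx.invFunOn_apply hZ, smul_inv_smul₀ (hx.det_pos Z hZ).ne']
        have := ((hasDerivAt_id (0 : ℝ)).smul_const (h Z)).const_add (M Z)
        simpa using this)
      (C := C) (c := c) (by simpa only [hM0] using hC) hK hKΩ
      (Or.inr fun y hy => ⟨rfl, by simp only [hoff y hy, smul_zero]⟩)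
      (fun χ hχ l hl => by
        simp only [hM0]
        refine hloc (isClosed_tsupport h) hx (fun _ _ => rfl) (fun Z hZ => ?_) χ hχ
        simp [image_eq_zero_of_notMem_tsupport hZ])
    simp only [hM0] at key
    refine key.congr_deriv ?_
    rw [hx.setIntegral_eq hΩ₀]
    refine setIntegral_congr_fun hΩ₀.measurableSet fun Z hZ => ?_
    have hne := (hx.det_pos Z hZ).ne'
    simp only [hx.invFunOn_apply hZ, momentumDeriv, PiLp.zero_apply, mul_zero,
      Finset.sum_const_zero, zero_add, Finset.mul_sum, PiLp.smul_apply, smul_eq_mul]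
    refine Finset.sum_congr rfl fun i _ => ?_
    field_simp

end IsPlacement

/-- Any continuous functional derivatives, including those occurring in the canonical equations, can
thus be replaced by the explicit ones. -/
lemma HasLagrangianDeriv.eqOn {Ω₀ : Set Space3} (hΩ₀ : IsOpen Ω₀)
    {Ψ : (Space3 → Space3) → (Space3 → Space3) → ℝ} {x M A B A' B' : Space3 → Space3}
    (h : HasLagrangianDeriv Ω₀ Ψ x M A B) (h' : HasLagrangianDeriv Ω₀ Ψ x M A' B') :
    EqOn A A' Ω₀ ∧ EqOn B B' Ω₀ :=
  ⟨h.deriv_x.eqOn hΩ₀ h'.deriv_x h.cont_x h'.cont_x,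
    h.deriv_M.eqOn hΩ₀ h'.deriv_M h.cont_M h'.cont_M⟩

/-! ### The theorem -/

theorem mainTheorem1 (Ω₀ Ω : Set Space3) (hΩ₀ : IsOpen Ω₀) (hΩ : IsOpen Ω)
    (ρ₀ s₀ : Space3 → ℝ) (hρ₀ : ContDiffOn ℝ ∞ ρ₀ Ω₀) (hs₀ : ContDiffOn ℝ ∞ s₀ Ω₀) :
    -- the canonical bracket of functionals of the Eulerian fields is the Eulerian bracket
    (∀ (x M : Space3 → Space3), IsPlacement Ω₀ Ω x → ContDiffOn ℝ ∞ M Ω₀ →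
      ∀ (C D : (Space3 → EulerValue) → ℝ) (c d : Space3 → EulerValue),
        HasFrechetDeriv Ω C (eulerianFields Ω₀ Ω ρ₀ s₀ x M) c →
        HasFrechetDeriv Ω D (eulerianFields Ω₀ Ω ρ₀ s₀ x M) d →
        VanishAtBoundary Ω c d →
        (∃ Cx CM : Space3 → Space3,
          HasLagrangianDeriv Ω₀ (pullback Ω₀ Ω ρ₀ s₀ C) x M Cx CM) ∧
        (∃ Dx DM : Space3 → Space3,
          HasLagrangianDeriv Ω₀ (pullback Ω₀ Ω ρ₀ s₀ D) x M Dx DM) ∧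
        EulerianBracketConverges Ω (eulerianFields Ω₀ Ω ρ₀ s₀ x M) c d ∧
        ∀ Cx CM Dx DM : Space3 → Space3,
          HasLagrangianDeriv Ω₀ (pullback Ω₀ Ω ρ₀ s₀ C) x M Cx CM →
          HasLagrangianDeriv Ω₀ (pullback Ω₀ Ω ρ₀ s₀ D) x M Dx DM →
          IntegrableOn (lagrangianDensity Cx CM Dx DM) Ω₀ ∧
          lagrangianBracket Ω₀ Cx CM Dx DM
            = eulerianBracket Ω (eulerianFields Ω₀ Ω ρ₀ s₀ x M) c d) ∧
    -- the Eulerian bracket generates the evolution of the Eulerian fields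
    (∀ (J : Set ℝ) (x M : ℝ → Space3 → Space3) (E : (Space3 → EulerValue) → ℝ)
        (e : ℝ → Space3 → EulerValue),
      IsOpen J →
      IsHamiltonianMotion Ω₀ Ω (pullback Ω₀ Ω ρ₀ s₀ E) J x M →
      (∀ t ∈ J, HasFrechetDeriv Ω E (eulerianFields Ω₀ Ω ρ₀ s₀ (x t) (M t)) (e t)) →
      ∀ t ∈ J, ∀ (C : (Space3 → EulerValue) → ℝ) (c : Space3 → EulerValue),
        IsLocalized Ω C →
        HasFrechetDeriv Ω C (eulerianFields Ω₀ Ω ρ₀ s₀ (x t) (M t)) c →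
        EulerianBracketConverges Ω (eulerianFields Ω₀ Ω ρ₀ s₀ (x t) (M t)) c (e t) ∧
        HasDerivAt (fun τ => C (eulerianFields Ω₀ Ω ρ₀ s₀ (x τ) (M τ)))
          (eulerianBracket Ω (eulerianFields Ω₀ Ω ρ₀ s₀ (x t) (M t)) c (e t)) t) := by
  refine ⟨?_, ?_⟩
  · intro x M hx hM C D c d hC hD hvan
    have hq := hx.contDiffOn_eulerianFields hΩ₀ hΩ hρ₀ hs₀ hM
    have hCL := hx.hasLagrangianDeriv_pullback hΩ₀ hΩ hρ₀ hs₀ hM hC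
    have hDL := hx.hasLagrangianDeriv_pullback hΩ₀ hΩ hρ₀ hs₀ hM hD
    obtain ⟨hconv, hint, heq⟩ := eulerianBracket_eq_integral_force hΩ hq hC.smooth hD.smooth hvan
    refine ⟨⟨_, _, hCL⟩, ⟨_, _, hDL⟩, hconv, fun Cx CM Dx DM h1 h2 => ?_⟩
    obtain ⟨e1, e2⟩ := h1.eqOn hΩ₀ hCL
    obtain ⟨e3, e4⟩ := h2.eqOn hΩ₀ hDL
    -- Both δ/δx carry the Jacobian and both δ/δM do not, so exactly one factor det appears, as the
    -- change of variables requires.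
    have hden : EqOn (lagrangianDensity Cx CM Dx DM) (fun Z => (fderiv ℝ x Z).det *
        ∑ i, (force (eulerianFields Ω₀ Ω ρ₀ s₀ x M) c (x Z) i * (d (x Z)).mom i
          - force (eulerianFields Ω₀ Ω ρ₀ s₀ x M) d (x Z) i * (c (x Z)).mom i)) Ω₀ := by
      intro Z hZ
      simp only [lagrangianDensity, e1 hZ, e2 hZ, e3 hZ, e4 hZ, placementDeriv, momentumDeriv,
        Finset.mul_sum]
      exact Finset.sum_congr rfl fun i _ => by ring
    refine ⟨(integrableOn_congr_fun hden hΩ₀.measurableSet).2 ((hx.integrableOn_iff hΩ₀ _).1 hint),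
      ?_⟩
    rw [lagrangianBracket, setIntegral_congr_fun hΩ₀.measurableSet hden, heq,
      hx.setIntegral_eq hΩ₀]
  · intro J x M E e hJ hmot hE t ht C c hloc hC
    obtain ⟨K, hK, hKΩ, hCK⟩ := hloc
    have hsm : IsSmoothMotion Ω₀ Ω J x M := ⟨hmot.placement, hmot.smooth_x, hmot.smooth_M⟩
    have hx := hmot.placement t ht
    have hM : ContDiffOn ℝ ∞ (M t) Ω₀ := hmot.smooth_M.comp
      (contDiff_prodMk_right t).contDiffOn fun Z hZ => ⟨ht, hZ⟩
    have hq := hx.contDiffOn_eulerianFields hΩ₀ hΩ hρ₀ hs₀ hM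
    -- Localization of `C` supplies the boundary condition with no restriction on `E` near the
    -- boundary.
    have hc0 : ∀ y ∈ Ω \ K, c y = 0 := hC.eq_zero_of_localized hΩ hK hCK
    obtain ⟨hconv, -, heq⟩ := eulerianBracket_eq_integral_force hΩ hq hC.smooth (hE t ht).smooth
      ⟨K, hK, hKΩ, Or.inr (Or.inl hc0)⟩
    refine ⟨hconv, ?_⟩
    obtain ⟨Hx, HM, hH, hcan⟩ := hmot.canonical t ht
    obtain ⟨e1, e2⟩ := hH.eqOn hΩ₀
      (hx.hasLagrangianDeriv_pullback hΩ₀ hΩ hρ₀ hs₀ hM (hE t ht))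
    -- The canonical equations in spatial form: the velocity is E_m. Since `force` is δ/δx per unit
    -- spatial volume, ∂ₜM = -δ/δx makes P its negative.
    have key := hsm.hasDerivAt_functional hΩ₀ hΩ hJ hρ₀ hs₀ ht (v := fun y => (e t y).mom)
      (P := fun y => WithLp.toLp 2 fun i =>
        -force (eulerianFields Ω₀ Ω ρ₀ s₀ (x t) (M t)) (e t) y i)
      (hE t ht).smooth.snd.fst
      ((PiLp.continuous_toLp 2 _).comp_continuousOn (continuousOn_pi.2 fun i =>
        (contDiffOn_force hΩ hq (hE t ht).smooth i).continuousOn.neg))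
      (fun Z hZ => by
        have := (hcan Z hZ).1
        rwa [e2 hZ] at this)
      (fun Z hZ => by
        refine (hcan Z hZ).2.congr_deriv ?_
        rw [e1 hZ]
        ext i
        simp [placementDeriv])
      hC hK hKΩ (Or.inl hc0)
      (fun χ hχ τ hτ => hCK _ _ fun y hy => by simp [hχ y hy])
    refine key.congr_deriv ?_
    rw [heq]
    refine setIntegral_congr_fun hΩ.measurableSet fun y hy => ?_
    simp only [← Finset.sum_add_distrib]
    exact Finset.sum_congr rfl fun i _ => by ring
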